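/- Let $b\ge 2$, $\alpha,d\ge 1$ and $s$ be integers ($s\ge 0$), and let $f:[0,1]^s\to\mathbb R$ be integrable with $V_\alpha(f)<\infty$, where $V_\alpha$ is defined below. Let $\boldsymbol\ell=(l_1,\dots,l_{ds})\in\mathbb N_0^{ds}$. Then $$\sigma_{d,\boldsymbol\ell,s}(f)\le 2^{s\max(d-\alpha,0)}\,\gamma(\boldsymbol\ell)\,V_\alpha(f).$$ **Interlacing.** For $x_1,\dots,x_d\in[0,1)$ with base $b$ expansions $x_r=\sum_{a\ge1}\xi_{r,a}b^{-a}$ (infinitely many digits different from $b-1$) and $k_1,\dots,k_d\in\mathbb N_0$ with $k_r=\sum_{a\ge0}\kappa_{r,a}b^a$ put $$\mathscr D_d(x_1,\dots,x_d)=\sum_{a=1}^\infty\sum_{r=1}^d\xi_{r,a}b^{-r-(a-1)d},\qquad \mathscr D_d(k_1,\dots,k_d)=\sum_{a=0}^\infty\sum_{r=1}^d\kappa_{r,a}b^{r-1+ad}.$$ On $[0,1)^{ds}$ and $\mathbb N_0^{ds}$, $\mathscr D_d$ acts on the $s$ consecutive blocks of $d$ coordinates. **Walsh coefficients.** For $x\in[0,1)$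 with digits $x_1,x_2,\dots$ (as above) and $k=\sum_a\kappa_ab^a$ let $\mathrm{wal}_k(x)=e^{2\pi i(\kappa_0x_1+\kappa_1x_2+\cdots)/b}$; for $\boldsymbol k\in\mathbb N_0^s$ let $\mathrm{wal}_{\boldsymbol k}(\boldsymbol x)=\prod_{i=1}^s\mathrm{wal}_{k_i}(x_i)$ and $\widehat f(\boldsymbol k)=\int_{[0,1]^s}f(\boldsymbol x)\overline{\mathrm{wal}_{\boldsymbol k}(\boldsymbol x)}\,d\boldsymbol x$. Let $B_{d,\boldsymbol\ell,s}=\{\boldsymbol k\in\mathbb N_0^{ds}:\lfloor b^{l_j-1}\rfloor\le k_j<b^{l_j},\ 1\le j\le ds\}$ and $\sigma_{d,\boldsymbol\ell,s}(f)=\big(\sum_{\boldsymbol k\in B_{d,\boldsymbol\ell,s}}|\widehat f(\mathscr D_d(\boldsymbol k))|^2\big)^{1/2}$. **The factor $\gamma(\boldsymbol\ell)$.** For $1\le i\le s$ let $K_i=\{j:(i-1)d<j\le id,\ l_j>0\}$, $\alpha_i=\min(\alpha,|K_i|)$, and $\gamma'_j=(b-1)b^{-j+(i-1)d-(l_j-1)d}$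 for $j\in K_i$ (these are pairwise distinct for each $i$). Let $\gamma_{i,1}<\dots<\gamma_{i,\alpha_i}$ be the $\alpha_i$ smallest of the numbers $\gamma'_j$, $j\in K_i$, and $\gamma(\boldsymbol\ell)=\prod_{i=1}^s\prod_{j=1}^{\alpha_i}\gamma_{i,j}$. **Variation.** For $n\ge0$, $g:[0,1]^n\to\mathbb R$, $\boldsymbol\alpha=(\alpha_1,\dots,\alpha_n)\in\{1,\dots,\alpha\}^n$ and $\boldsymbol z_i=(z_{i,1},\dots,z_{i,\alpha_i})$ let $$\Delta_{\boldsymbol\alpha}(\boldsymbol t;\boldsymbol z_1,\dots,\boldsymbol z_n)g=\sum_{v_1\subseteq\{1,\dots,\alpha_1\}}\cdots\sum_{v_n\subseteq\{1,\dots,\alpha_n\}}(-1)^{|v_1|+\cdots+|v_n|}\,g\Big(t_1+\sum_{r\in v_1}z_{1,r},\dots,t_n+\sum_{r\in v_n}z_{n,r}\Big)$$ and $$V^{(n)}_{\boldsymbol\alpha}(g)=\sup_{\mathcal P}\Big(\sum_{J\in\mathcal P}\mathrm{Vol}(\mathscr D_\alpha(J))\,\sup\Big|\frac{\Delta_{\boldsymbol\alpha}(\boldsymbol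 t;\boldsymbol z_1,\dots,\boldsymbol z_n)g}{\prod_{i=1}^n\prod_{r=1}^{\alpha_i}z_{i,r}}\Big|^2\Big)^{1/2}.$$ Here $\mathcal P$ runs over all finite partitions of $[0,1)^{\alpha n}$ into boxes $J=\prod_{j=1}^{\alpha n}[a_jb^{-m_j},(a_j+1)b^{-m_j})$ with integers $m_j\ge1$, $0\le a_j<b^{m_j}$; the inner supremum is over all $\boldsymbol t\in\mathscr D_\alpha(J)$ and all $z_{i,r}=\tau_{i,r}\,b^{-\alpha(m_{(i-1)\alpha+r}-1)-r}$ with $\tau_{i,r}\in\{1-b,\dots,b-1\}\setminus\{0\}$ ($1\le r\le\alpha_i$, $1\le i\le n$) such that all points at which $g$ is evaluated in the difference lie in $\mathscr D_\alpha\big(\prod_{j}[b^{-m_j+1}\lfloor a_j/b\rfloor,\ b^{-m_j+1}(\lfloor a_j/b\rfloor+1))\big)$. For $n=0$ this is the absolute value of the constant $g$. For $u\subseteq\{1,\dots,s\}$ let $f_u(\boldsymbol x_u)=\int_{[0,1]^{s-|u|}}f(\boldsymbol x)\,d\boldsymbol x_{\{1,\dots,s\}\setminus u}$ (with the value $0$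 at those $\boldsymbol x_u$, a null set, where the integrand is not integrable). Then $$V_\alpha(f)=\Big(\sum_{u\subseteq\{1,\dots,s\}}\ \sum_{\boldsymbol\alpha\in\{1,\dots,\alpha\}^{|u|}}\big(V^{(|u|)}_{\boldsymbol\alpha}(f_u)\big)^2\Big)^{1/2}.$$ -/

import Mathlib

/-! Digit interlacing, Walsh coefficients and the generalized Hardy and Krause variation.
Coordinates and digit positions are counted from `0`: a point of `[0,1)^{ds}` is a function
`ι → Fin d → ℝ`, where `ι` has `s` elements and the entry `(i, r)` is the coordinate usually
numbered `(i - 1) d + r` (with `i`, `r` counted from `1`). -/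

namespace HigherOrderScrambling

/-- The digit `ξ_{a+1}` of `x = ξ₁ b⁻¹ + ξ₂ b⁻² + ⋯ ∈ [0,1)`, for the expansion in which
infinitely many digits differ from `b - 1`. -/
noncomputable def digit (b : ℕ) (x : ℝ) (a : ℕ) : ℕ :=
  ⌊x * (b : ℝ) ^ (a + 1)⌋₊ % b

/-- The digit `κ_a` of `k = κ₀ + κ₁ b + ⋯`. -/
def natDigit (b k a : ℕ) : ℕ :=
  k / b ^ a % b

/-- Digit interlacing `[0,1)^d → [0,1)`,
`(x₁, …, x_d) ↦ ∑_{a ≥ 1} ∑_{r=1}^d ξ_{r,a} b^{-r-(a-1)d}`. -/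
noncomputable def interlace (b d : ℕ) (x : Fin d → ℝ) : ℝ :=
  ∑' a : ℕ, ∑ r : Fin d, (digit b (x r) a : ℝ) * ((b : ℝ) ^ ((r : ℕ) + 1 + a * d))⁻¹

/-- Digit interlacing `ℕ₀^d → ℕ₀`, `(k₁, …, k_d) ↦ ∑_{a ≥ 0} ∑_{r=1}^d κ_{r,a} b^{r-1+ad}`
(for `b ≥ 2` the digits `κ_{r,a}` with `a ≥ k_r` vanish). -/
def interlaceNat (b d : ℕ) (k : Fin d → ℕ) : ℕ :=
  ∑ r : Fin d, ∑ a ∈ Finset.range (k r), natDigit b (k r) a * b ^ ((r : ℕ) + a * d)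

/-- Digit interlacing `[0,1)^{ds} → [0,1)^s`, block by block. -/
noncomputable def interlaceVec (b d : ℕ) {ι : Type*} (x : ι → Fin d → ℝ) : ι → ℝ :=
  fun i => interlace b d (x i)

/-- The `k`th Walsh function in base `b`: `ω_b^{κ₀ x₁ + κ₁ x₂ + ⋯}` with `ω_b = e^{2πi/b}`
(for `b ≥ 2` the digits `κ_a` with `a ≥ k` vanish). -/
noncomputable def walsh (b k : ℕ) (x : ℝ) : ℂ :=
  Complex.exp (2 * Real.pi * Complex.I / b) ^
    (∑ a ∈ Finset.range k, natDigit b k a * digit b x a)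

/-- The Walsh coefficient `∫_{[0,1]^s} f(x) conj(wal_k(x)) dx`, `k ∈ ℕ₀^s`. -/
noncomputable def walshCoeff (b : ℕ) {s : ℕ} (f : (Fin s → ℝ) → ℝ) (k : Fin s → ℕ) : ℂ :=
  ∫ x in Set.Icc (0 : Fin s → ℝ) 1, (f x : ℂ) * (starRingEnd ℂ) (∏ i, walsh b (k i) (x i))

/-- The block `B_{d,ℓ,s}` of all `k ∈ ℕ₀^{ds}` with `⌊b^{l_j - 1}⌋ ≤ k_j < b^{l_j}`
(`b ^ l / b` is a rounded-down quotient, so it is `b^{l-1}` for `l ≥ 1` and `0` for `l = 0`). -/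
def walshBlock (b d : ℕ) {s : ℕ} (l : Fin s → Fin d → ℕ) : Finset (Fin s → Fin d → ℕ) :=
  Fintype.piFinset fun i => Fintype.piFinset fun r =>
    Finset.Ico (b ^ l i r / b) (b ^ l i r)

/-- `σ_{d,ℓ,s}(f)`, the `ℓ₂`-norm of the Walsh coefficients of `f` at the interlaced indices
of the block `B_{d,ℓ,s}`. -/
noncomputable def sigma (b d : ℕ) {s : ℕ} (l : Fin s → Fin d → ℕ) (f : (Fin s → ℝ) → ℝ) : ℝ :=
  Real.sqrt (∑ k ∈ walshBlock b d l,
    ‖walshCoeff b f (fun i => interlaceNat b d (k i))‖ ^ 2)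

/-- The factor `γ'_j = (b-1) b^{-j+(i-1)d-(l_j-1)d}` for `j = (i-1)d + r + 1`, where `r` is the
position (counted from `0`) in the block of the coordinate and `l = l_j`. -/
noncomputable def gammaFactor (b d : ℕ) (r l : ℕ) : ℝ :=
  ((b : ℝ) - 1) * (b : ℝ) ^ (-((r : ℤ) + 1) - ((l : ℤ) - 1) * (d : ℤ))

/-- The set `K_i` of positions with nonzero `l_j` in the block of one coordinate. -/
def support {d : ℕ} (l : Fin d → ℕ) : Finset (Fin d) :=
  Finset.univ.filter fun r => 0 < l r

/-- The positions in `K_i` of the `α_i = min(α, |K_i|)` smallest factors: those with fewer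
than `α` smaller factors in `K_i` (the factors are pairwise distinct). -/
noncomputable def smallest (b d α : ℕ) (l : Fin d → ℕ) : Finset (Fin d) :=
  (support l).filter fun r : Fin d =>
    ((support l).filter fun r' : Fin d =>
      gammaFactor b d r' (l r') < gammaFactor b d r (l r)).card < α

/-- `γ(ℓ) = ∏_i ∏_{j=1}^{α_i} γ_{i,j}`. -/
noncomputable def gamma (b d α : ℕ) {s : ℕ} (l : Fin s → Fin d → ℕ) : ℝ :=
  ∏ i, ∏ r ∈ smallest b d α (l i), gammaFactor b d r (l i r)

section Variation

variable {ι : Type*} [Fintype ι] [DecidableEq ι]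

/-- The first `A i` of the indices `1, …, α`, for a multi-index `A ∈ {0, …, α}^ι`. -/
def firstIdx (α : ℕ) (A : ι → ℕ) (i : ι) : Finset (Fin α) :=
  Finset.univ.filter fun r : Fin α => (r : ℕ) < A i

/-- The point with coordinates `t_i + ∑_{r ∈ v_i} z_{i,r}`. -/
def shifted {α : ℕ} (t : ι → ℝ) (z : ι → Fin α → ℝ) (v : ι → Finset (Fin α)) : ι → ℝ :=
  fun i => t i + ∑ r ∈ v i, z i r

/-- The families of sets `v_i ⊆ {1, …, A i}`. -/
def subsets (α : ℕ) (A : ι → ℕ) : Finset (ι → Finset (Fin α)) :=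
  Fintype.piFinset fun i => (firstIdx α A i).powerset

/-- The finite difference `Δ_A(t; (z_{i,1}, …, z_{i,A i})_i) f`. -/
def difference {α : ℕ} (A : ι → ℕ) (t : ι → ℝ) (z : ι → Fin α → ℝ) (f : (ι → ℝ) → ℝ) : ℝ :=
  ∑ v ∈ subsets α A, (-1) ^ (∑ i, (v i).card) * f (shifted t z v)

/-- The `b`-adic box `∏_j [a_j b^{-l_j}, (a_j + 1) b^{-l_j})`. -/
def boxSet (b α : ℕ) (l a : ι → Fin α → ℕ) : Set (ι → Fin α → ℝ) :=
  {x | ∀ i r, (a i r : ℝ) / (b : ℝ) ^ l i r ≤ x i r ∧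
    x i r < ((a i r : ℝ) + 1) / (b : ℝ) ^ l i r}

/-- The data of a box `∏_j [a_j b^{-l_j}, (a_j + 1) b^{-l_j}) ⊆ [0,1)^{α|ι|}` with
`l_j ≥ 1` and `0 ≤ a_j < b^{l_j}`. -/
structure Box (b α : ℕ) (ι : Type*) where
  l : ι → Fin α → ℕ
  a : ι → Fin α → ℕ
  l_pos : ∀ i r, 1 ≤ l i r
  a_lt : ∀ i r, a i r < b ^ l i r

/-- The box `J` as a set. -/
def Box.toSet {b α : ℕ} (J : Box b α ι) : Set (ι → Fin α → ℝ) :=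
  boxSet b α J.l J.a

/-- The box `∏_j [b^{-l_j+1} ⌊a_j/b⌋, b^{-l_j+1} (⌊a_j/b⌋ + 1))`. -/
def Box.parent {b α : ℕ} (J : Box b α ι) : Set (ι → Fin α → ℝ) :=
  boxSet b α (fun i r => J.l i r - 1) (fun i r => J.a i r / b)

/-- `P` is a partition of `[0,1)^{α|ι|}`. -/
def IsPartition {b α : ℕ} (P : Finset (Box b α ι)) : Prop :=
  (P : Set (Box b α ι)).PairwiseDisjoint Box.toSet ∧
    (⋃ J ∈ P, J.toSet) = {x : ι → Fin α → ℝ | ∀ i r, 0 ≤ x i r ∧ x i r < 1}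

/-- The step `z_{i,r} = τ_{i,r} b^{-α(l_{i,r}-1)-r}` belonging to `J` (`r` counted from `1` in
the exponent). -/
noncomputable def Box.step {b α : ℕ} (J : Box b α ι) (τ : ι → Fin α → ℤ) : ι → Fin α → ℝ :=
  fun i r => (τ i r : ℝ) * (b : ℝ) ^ (-(α : ℤ) * ((J.l i r : ℤ) - 1) - (((r : ℕ) : ℤ) + 1))

/-- Admissible `t` and `τ` for the box `J`: `t ∈ 𝒟_α(J)`, the `τ_{i,r}` with `1 ≤ r ≤ A i` are in
`{1-b, …, b-1} \ {0}`, and every point at which `f` is evaluated in the difference lies in the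
image under `𝒟_α` of the parent box. -/
def Box.Admissible {b α : ℕ} (J : Box b α ι) (A : ι → ℕ) (t : ι → ℝ) (τ : ι → Fin α → ℤ) :
    Prop :=
  t ∈ interlaceVec b α '' J.toSet ∧
    (∀ i, ∀ r ∈ firstIdx α A i, τ i r ≠ 0 ∧ 1 - (b : ℤ) ≤ τ i r ∧ τ i r ≤ (b : ℤ) - 1) ∧
    ∀ v ∈ subsets α A, shifted t (J.step τ) v ∈ interlaceVec b α '' J.parent

/-- The squared supremum of the difference quotients of order `A` over the box `J`. -/
noncomputable def boxSup {b α : ℕ} (A : ι → ℕ) (f : (ι → ℝ) → ℝ) (J : Box b α ι) : ENNReal :=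
  ⨆ (t : ι → ℝ) (τ : ι → Fin α → ℤ) (_ : J.Admissible A t τ),
    ENNReal.ofReal (|difference A t (J.step τ) f /
      ∏ i, ∏ r ∈ firstIdx α A i, J.step τ i r| ^ 2)

/-- The generalized Vitali variation `V_A(f)` in base `b` of a function on `[0,1]^ι`, as an
extended nonnegative number. (For empty `ι` it is the absolute value of the only value.) -/
noncomputable def vitaliVariation (b α : ℕ) (A : ι → ℕ) (f : (ι → ℝ) → ℝ) : ENNReal :=
  ⨆ (P : Finset (Box b α ι)) (_ : IsPartition P),
    (∑ J ∈ P, MeasureTheory.volume (interlaceVec b α '' J.toSet) * boxSup A f J) ^ (1 / 2 : ℝ)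

end Variation

/-- The point of `ℝ^s` with coordinates `x` in `u` and `y` outside `u`. -/
def combine {s : ℕ} (u : Finset (Fin s)) (x : {i // i ∈ u} → ℝ) (y : {i // i ∉ u} → ℝ) :
    Fin s → ℝ :=
  fun i => if h : i ∈ u then x ⟨i, h⟩ else y ⟨i, h⟩

/-- The projection `f_u(x_u) = ∫_{[0,1]^{s-|u|}} f(x) dx_{{1,…,s} \ u}`. -/
noncomputable def projection {s : ℕ} (u : Finset (Fin s)) (f : (Fin s → ℝ) → ℝ)
    (x : {i // i ∈ u} → ℝ) : ℝ :=
  ∫ y in Set.Icc (0 : {i // i ∉ u} → ℝ) 1, f (combine u x y)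

/-- The generalized Hardy and Krause variation `V_α(f)` of order `α` in base `b`. -/
noncomputable def variation (b α : ℕ) {s : ℕ} (f : (Fin s → ℝ) → ℝ) : ENNReal :=
  (∑ u : Finset (Fin s), ∑ A ∈ Fintype.piFinset (fun _ : {i // i ∈ u} => Finset.Icc 1 α),
    vitaliVariation b α A (projection u f) ^ 2) ^ (1 / 2 : ℝ)

end HigherOrderScrambling

open MeasureTheory

namespace HigherOrderScrambling

/-! ### Digits of real numbers under `b`-adic shifts -/

/-! For every index $\boldsymbol k$ in the block, $\mathscr D_d(\boldsymbol k)$ has a nonzero digit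
at the position `leadPos` of each $j\in K_i$, and $\gamma'_j$ is $b-1$ times the weight of that
position. In each coordinate with $K_i\ne\emptyset$ only the positions of the smallest factors (at
most $\alpha$ of them) are used. The remaining coordinates have index $0$ and are integrated out,
which replaces $f$ by a projection $f_u$.

Prescribe values $c$ for the digits at the chosen positions and replace $f_u$ by the mixed
difference $\sum_v(-1)^{|v|}f_u(x\text{ with the digits in }v\text{ overwritten by }c)$. A term with
$v\neq\emptyset$ no longer depends on the overwritten digits, so it is orthogonal to every Walsh
function with a nonzero digit there: the Walsh coefficients do not change
(`integral_mixedDiff_mul_prodWalsh`). Bessel's inequality bounds $\sigma^2$ by the mean square of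
this difference, for every $c$. In the sum over all $c$, sorted by the digit changes
$\tau=c-\text{digits}(x)$, each pair $(\tau,x)$ occurs at most once (`sum_lintegral_mixedDiff_le`).

For fixed $\tau$ the difference has steps $\tau b^{-(p+1)}$ at arbitrary positions $p$, whereas the
variation uses one step in each of the first residue classes modulo $\alpha$. A greedy matching
(`exists_matching`) moves each $p$ to a position $p'\ge p$ in a class of its own. Each large step is
cut into $|\tau|b^{p'-p}$ steps of size $b^{-(p'+1)}$; telescoping and Cauchy–Schwarz then bound the
integral by $\prod(\tau b^{-(p+1)})^2V^2$, with no trace of $p'$ (`lintegral_mixedDiff_le`). The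
matching also ensures that all intermediate points stay in the image of the parent box, as the
variation demands.

Finally $\sum_{0<|\tau|<b}\tau^2\le b(b-1)^2$, and the factor $b$ is cancelled by the $b$ choices of
each $c_\theta$. The result is $\sigma\le\gamma V$ with constant $1$. -/

/-- The weight `b^{-(p+1)}` of the digit at position `p`. -/
noncomputable def digitUnit (b p : ℕ) : ℝ := ((b : ℝ) ^ (p + 1))⁻¹

lemma digitUnit_pos {b : ℕ} (hb : 2 ≤ b) (p : ℕ) : 0 < digitUnit b p := by
  unfold digitUnit
  have : (0 : ℝ) < b := by positivity
  positivity

lemma digitUnit_mul_pow {b : ℕ} (hb : 2 ≤ b) {p n : ℕ} (h : p < n) :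
    digitUnit b p * (b : ℝ) ^ n = (b : ℝ) ^ (n - (p + 1)) := by
  have : (b : ℝ) ≠ 0 := by positivity
  unfold digitUnit
  rw [inv_mul_eq_iff_eq_mul₀ (by positivity), ← pow_add, Nat.add_sub_cancel' h]

lemma digit_lt {b : ℕ} (hb : 2 ≤ b) (x : ℝ) (a : ℕ) : digit b x a < b :=
  Nat.mod_lt _ (by omega)

lemma digit_int {b : ℕ} {x : ℝ} (hx : 0 ≤ x) (a : ℕ) :
    (digit b x a : ℤ) = ⌊x * (b : ℝ) ^ (a + 1)⌋ % b := by
  unfold digit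
  rw [Int.natCast_mod, Int.natCast_floor_eq_floor (by positivity)]

lemma measurable_digit (b a : ℕ) : Measurable fun x : ℝ => digit b x a := by
  unfold digit
  exact (measurable_from_nat (f := fun n : ℕ => n % b)).comp
    (Nat.measurable_floor.comp (measurable_id.mul_const _))

lemma floor_mul_pow_succ (b : ℕ) (hb : 2 ≤ b) (x : ℝ) (n : ℕ) :
    ⌊x * (b : ℝ) ^ (n + 1)⌋₊ = b * ⌊x * (b : ℝ) ^ n⌋₊ + digit b x n := by
  have h := Nat.mul_cast_floor_div_cancel (n := b) (by omega) (x * (b : ℝ) ^ n)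
  rw [mul_assoc, ← pow_succ] at h
  rw [← h]
  exact (Nat.div_add_mod _ _).symm

lemma floor_eq_sum_digits {b : ℕ} (hb : 2 ≤ b) {x : ℝ} (hx : x < 1) (n : ℕ) :
    ⌊x * (b : ℝ) ^ n⌋₊ = ∑ a ∈ Finset.range n, digit b x a * b ^ (n - 1 - a) := by
  induction n with
  | zero => simp [Nat.floor_eq_zero, hx]
  | succ n ih =>
    rw [floor_mul_pow_succ b hb, ih, Finset.sum_range_succ, Finset.mul_sum]
    simp only [add_tsub_cancel_right, tsub_self, pow_zero, mul_one, add_left_inj]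
    refine Finset.sum_congr rfl fun a ha => ?_
    rw [show n - a = n - 1 - a + 1 by have := Finset.mem_range.1 ha; omega, pow_succ]
    ring

/-- Integer floors are used because shifted points are not yet known to be nonnegative. A floor at a
finer level determines all coarser ones. -/
lemma floor_level_le {b : ℕ} (hb : 2 ≤ b) (x : ℝ) {m n : ℕ} (h : m ≤ n) :
    ⌊x * (b : ℝ) ^ m⌋ = ⌊x * (b : ℝ) ^ n⌋ / ((b ^ (n - m) : ℕ) : ℤ) := by
  rw [← Int.floor_div_natCast]
  congr 1
  have : (b : ℝ) ≠ 0 := by positivity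
  push_cast
  rw [eq_div_iff (by positivity), mul_assoc, ← pow_add]
  congr 2
  omega

lemma floor_level_mono {b : ℕ} (hb : 2 ≤ b) {x y : ℝ} {m n : ℕ} (h : m ≤ n)
    (hxy : ⌊x * (b : ℝ) ^ n⌋ = ⌊y * (b : ℝ) ^ n⌋) :
    ⌊x * (b : ℝ) ^ m⌋ = ⌊y * (b : ℝ) ^ m⌋ := by
  rw [floor_level_le hb x h, floor_level_le hb y h, hxy]

/-- Level $0$ of the floors decides the sign. Positivity of shifted points is needed since `digit`
truncates negative numbers. -/
lemma nonneg_of_floor {b : ℕ} (hb : 2 ≤ b) {x y : ℝ} {m : ℕ} (hx : 0 ≤ x)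
    (hxy : ⌊y * (b : ℝ) ^ m⌋ = ⌊x * (b : ℝ) ^ m⌋) : 0 ≤ y := by
  have h := floor_level_mono hb (Nat.zero_le m) hxy
  simp only [pow_zero, mul_one] at h
  have : 0 ≤ ⌊x⌋ := Int.floor_nonneg.2 hx
  exact Int.floor_nonneg.1 (h ▸ this)

lemma floor_add_unit {b : ℕ} (hb : 2 ≤ b) (x : ℝ) (τ : ℤ) {p n : ℕ} (h : p < n) :
    ⌊(x + τ * digitUnit b p) * (b : ℝ) ^ n⌋
      = ⌊x * (b : ℝ) ^ n⌋ + τ * (b : ℤ) ^ (n - (p + 1)) := by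
  rw [add_mul, mul_assoc, digitUnit_mul_pow hb h, ← Int.floor_add_intCast]
  push_cast
  rfl

/-- Carries only run towards earlier positions: scaled to level $n+1$, the shift is a multiple of
$b$. Hence no condition on carries appears. -/
lemma digit_add_unit_of_lt {b : ℕ} (hb : 2 ≤ b) {x : ℝ} (hx : 0 ≤ x) (τ : ℤ) {p n : ℕ}
    (h : p < n) (hx' : 0 ≤ x + τ * digitUnit b p) :
    digit b (x + τ * digitUnit b p) n = digit b x n := by
  have : (digit b (x + τ * digitUnit b p) n : ℤ) = digit b x n := by
    rw [digit_int hx', digit_int hx, floor_add_unit hb x τ (by omega),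
      show n + 1 - (p + 1) = (n - p - 1) + 1 by omega, pow_succ (b : ℤ), ← mul_assoc,
      Int.add_mul_emod_self_right]
  exact_mod_cast this

lemma floor_add_unit_of_le {b : ℕ} (hb : 2 ≤ b) {x : ℝ} (hx : 0 ≤ x) {τ : ℤ} {p : ℕ}
    (h0 : 0 ≤ (digit b x p : ℤ) + τ) (h1 : (digit b x p : ℤ) + τ < b) {n : ℕ} (h : n ≤ p) :
    ⌊(x + τ * digitUnit b p) * (b : ℝ) ^ n⌋ = ⌊x * (b : ℝ) ^ n⌋ := by
  refine floor_level_mono hb h ?_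
  rw [floor_level_le hb _ (Nat.le_succ p), floor_level_le hb x (Nat.le_succ p),
    floor_add_unit hb x τ (Nat.lt_succ_self p)]
  rw [digit_int hx] at h0 h1
  simp only [Nat.succ_eq_add_one, add_tsub_cancel_left, pow_one, tsub_self, pow_zero, mul_one]
  have hb' : (0 : ℤ) < b := by omega
  set F := ⌊x * (b : ℝ) ^ (p + 1)⌋
  rw [show F + τ = (F % b + τ) + b * (F / b) by rw [add_right_comm, Int.emod_add_mul_ediv],
    Int.add_mul_ediv_left _ _ hb'.ne', Int.ediv_eq_zero_of_lt h0 h1, zero_add]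

lemma add_unit_nonneg {b : ℕ} (hb : 2 ≤ b) {x : ℝ} (hx : 0 ≤ x) {τ : ℤ} {p : ℕ}
    (h0 : 0 ≤ (digit b x p : ℤ) + τ) (h1 : (digit b x p : ℤ) + τ < b) :
    0 ≤ x + τ * digitUnit b p :=
  nonneg_of_floor hb hx (floor_add_unit_of_le hb hx h0 h1 (Nat.zero_le p))

lemma digit_add_unit_of_ne {b : ℕ} (hb : 2 ≤ b) {x : ℝ} (hx : 0 ≤ x) {τ : ℤ} {p n : ℕ}
    (h0 : 0 ≤ (digit b x p : ℤ) + τ) (h1 : (digit b x p : ℤ) + τ < b) (h : n ≠ p) :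
    digit b (x + τ * digitUnit b p) n = digit b x n := by
  have hx' := add_unit_nonneg hb hx h0 h1
  rcases lt_or_gt_of_ne h with h | h
  · have : (digit b (x + τ * digitUnit b p) n : ℤ) = digit b x n := by
      rw [digit_int hx', digit_int hx, floor_add_unit_of_le hb hx h0 h1 (by omega)]
    exact_mod_cast this
  · exact digit_add_unit_of_lt hb hx τ h hx'

lemma digit_add_unit_self {b : ℕ} (hb : 2 ≤ b) {x : ℝ} (hx : 0 ≤ x) {τ : ℤ} {p : ℕ}
    (h0 : 0 ≤ (digit b x p : ℤ) + τ) (h1 : (digit b x p : ℤ) + τ < b) :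
    (digit b (x + τ * digitUnit b p) p : ℤ) = digit b x p + τ := by
  have hx' := add_unit_nonneg hb hx h0 h1
  rw [← Int.emod_eq_of_lt h0 h1, digit_int hx', digit_int hx,
    floor_add_unit hb x τ (Nat.lt_succ_self p)]
  simp

section MultiShift

variable {κ : Type*}

/-- Changing the digits at the distinct positions `p r`, `r ∈ R`, by `τ r` without carry. -/
lemma digits_add_sum_units {b : ℕ} (hb : 2 ≤ b) {x : ℝ} (hx : 0 ≤ x) (R : Finset κ) (p : κ → ℕ)
    (τ : κ → ℤ) (hp : Set.InjOn p R)
    (h0 : ∀ r ∈ R, 0 ≤ (digit b x (p r) : ℤ) + τ r)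
    (h1 : ∀ r ∈ R, (digit b x (p r) : ℤ) + τ r < b) :
    0 ≤ x + ∑ r ∈ R, τ r * digitUnit b (p r) ∧
    (∀ n, (∀ r ∈ R, n ≤ p r) →
      ⌊(x + ∑ r ∈ R, τ r * digitUnit b (p r)) * (b : ℝ) ^ n⌋ = ⌊x * (b : ℝ) ^ n⌋) ∧
    (∀ n, (∀ r ∈ R, n ≠ p r) →
      digit b (x + ∑ r ∈ R, τ r * digitUnit b (p r)) n = digit b x n) ∧
    ∀ r ∈ R, (digit b (x + ∑ r ∈ R, τ r * digitUnit b (p r)) (p r) : ℤ)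
      = digit b x (p r) + τ r := by
  classical
  induction R using Finset.induction_on with
  | empty => simp [hx]
  | insert r R hr ih =>
    obtain ⟨i0, i1, i2, i3⟩ := ih (hp.mono (by simp))
      (fun s hs => h0 s (Finset.mem_insert_of_mem hs)) (fun s hs => h1 s (Finset.mem_insert_of_mem hs))
    have hne : ∀ s ∈ R, p r ≠ p s := fun s hs h => by
      have := hp (by simp) (by simp [hs]) h
      exact hr (this ▸ hs)
    rw [Finset.sum_insert hr, add_comm (_ * _), ← add_assoc]
    set y := x + ∑ r ∈ R, τ r * digitUnit b (p r)
    have e : digit b y (p r) = digit b x (p r) := i2 _ hne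
    have g0 : 0 ≤ (digit b y (p r) : ℤ) + τ r := e ▸ h0 r (by simp)
    have g1 : (digit b y (p r) : ℤ) + τ r < b := e ▸ h1 r (by simp)
    refine ⟨add_unit_nonneg hb i0 g0 g1, fun n hn => ?_, fun n hn => ?_, fun s hs => ?_⟩
    · rw [floor_add_unit_of_le hb i0 g0 g1 (hn r (by simp)), i1]
      exact fun s hs => hn s (by simp [hs])
    · rw [digit_add_unit_of_ne hb i0 g0 g1 (hn r (by simp)), i2]
      exact fun s hs => hn s (by simp [hs])
    · rcases Finset.mem_insert.1 hs with rfl | hs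
      · rw [digit_add_unit_self hb i0 g0 g1, e]
      · rw [digit_add_unit_of_ne hb i0 g0 g1 (hne s hs).symm, i3 s hs]

/-- Shifts dominated by changes of digits without carry keep the leading digits. -/
lemma floor_add_dominated {b : ℕ} (hb : 2 ≤ b) {x : ℝ} (hx : 0 ≤ x) (R : Finset κ) (p : κ → ℕ)
    (τ : κ → ℤ) (hp : Set.InjOn p R)
    (h0 : ∀ r ∈ R, 0 ≤ (digit b x (p r) : ℤ) + τ r)
    (h1 : ∀ r ∈ R, (digit b x (p r) : ℤ) + τ r < b) (s : κ → ℝ)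
    (hs0 : ∀ r ∈ R, ((min 0 (τ r) : ℤ) : ℝ) * digitUnit b (p r) ≤ s r)
    (hs1 : ∀ r ∈ R, s r ≤ ((max 0 (τ r) : ℤ) : ℝ) * digitUnit b (p r))
    {n : ℕ} (hn : ∀ r ∈ R, n ≤ p r) :
    ⌊(x + ∑ r ∈ R, s r) * (b : ℝ) ^ n⌋ = ⌊x * (b : ℝ) ^ n⌋ := by
  have hlt : ∀ r, (digit b x (p r) : ℤ) < b := fun r => by exact_mod_cast digit_lt hb x (p r)
  -- The shifted point lies between the points where only the negative, respectively only the
  -- positive, changes are made. Both are free of carries and share the leading digits of $x$, so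
  -- monotonicity of the floor suffices.
  obtain ⟨-, l1, -⟩ := digits_add_sum_units hb hx R p (fun r => min 0 (τ r)) hp
    (fun r hr => by have := h0 r hr; omega)
    (fun r hr => by have := hlt r; omega)
  obtain ⟨-, u1, -⟩ := digits_add_sum_units hb hx R p (fun r => max 0 (τ r)) hp
    (fun r hr => by omega)
    (fun r hr => by have := hlt r; have := h1 r hr; omega)
  apply le_antisymm
  · rw [← u1 n hn]
    gcongr with r hr
    exact hs1 r hr
  · rw [← l1 n hn]
    gcongr with r hr
    exact hs0 r hr

/-- Shifts of the digits at positions `p r, …, p' r`, dominated by a change of the leading one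
of these digits without carry, do not affect the other digits. -/
lemma digit_add_dominated {b : ℕ} (hb : 2 ≤ b) {x : ℝ} (hx : 0 ≤ x) (R : Finset κ) (p p' : κ → ℕ)
    (τ : κ → ℤ) (hp : Set.InjOn p R)
    (h0 : ∀ r ∈ R, 0 ≤ (digit b x (p r) : ℤ) + τ r)
    (h1 : ∀ r ∈ R, (digit b x (p r) : ℤ) + τ r < b) (g : κ → ℤ)
    (hs0 : ∀ r ∈ R, ((min 0 (τ r) : ℤ) : ℝ) * digitUnit b (p r) ≤ g r * digitUnit b (p' r))
    (hs1 : ∀ r ∈ R, g r * digitUnit b (p' r) ≤ ((max 0 (τ r) : ℤ) : ℝ) * digitUnit b (p r))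
    {n : ℕ} (hn : ∀ r ∈ R, n < p r ∨ p' r < n) :
    digit b (x + ∑ r ∈ R, g r * digitUnit b (p' r)) n = digit b x n := by
  classical
  have hx' : 0 ≤ x + ∑ r ∈ R, g r * digitUnit b (p' r) :=
    nonneg_of_floor hb hx (floor_add_dominated hb hx R p τ hp h0 h1 _ hs0 hs1
      (n := 0) fun _ _ => Nat.zero_le _)
  -- Shifts starting after position $n$ leave the floor at level $n+1$ alone; all others end before
  -- $n$ and add a multiple of $b$ to it.
  have key : (digit b (x + ∑ r ∈ R, g r * digitUnit b (p' r)) n : ℤ) = digit b x n := by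
    rw [digit_int hx', digit_int hx, ← Finset.sum_filter_add_sum_filter_not R (fun r => n < p r),
      ← add_assoc]
    have hsub : R.filter (fun r => n < p r) ⊆ R := Finset.filter_subset _ _
    have hi := floor_add_dominated hb hx (R.filter fun r => n < p r) p τ
      (hp.mono (by exact_mod_cast hsub)) (fun r hr => h0 r (hsub hr))
      (fun r hr => h1 r (hsub hr)) _ (fun r hr => hs0 r (hsub hr)) (fun r hr => hs1 r (hsub hr))
      (n := n + 1) (fun r hr => (Finset.mem_filter.1 hr).2)
    rw [← hi]
    set y := x + ∑ r ∈ R.filter (fun r => n < p r), g r * digitUnit b (p' r)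
    have hc : (∑ r ∈ R.filter (fun r => ¬ n < p r), (g r : ℝ) * digitUnit b (p' r))
        * (b : ℝ) ^ (n + 1) =
        ((b * ∑ r ∈ R.filter (fun r => ¬ n < p r), g r * (b : ℤ) ^ (n - (p' r + 1)) : ℤ) : ℝ) := by
      push_cast
      rw [Finset.sum_mul, Finset.mul_sum]
      refine Finset.sum_congr rfl fun r hr => ?_
      obtain ⟨hr, hr'⟩ := Finset.mem_filter.1 hr
      have hlt : p' r < n := (hn r hr).resolve_left hr'
      rw [mul_assoc, digitUnit_mul_pow hb (by omega),
        show n + 1 - (p' r + 1) = n - (p' r + 1) + 1 by omega, pow_succ]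
      ring
    rw [add_mul, hc, Int.floor_add_intCast, Int.add_mul_emod_self_left]
  exact_mod_cast key

end MultiShift

/-! ### Points with interlaced digit expansions -/

lemma ofDigits_lt_one {b : ℕ} (hb : 2 ≤ b) (D : ℕ → Fin b) (h : ∃ a, (D a : ℕ) ≠ b - 1) :
    Real.ofDigits D < 1 := by
  obtain ⟨a, ha⟩ := h
  rw [← Real.ofDigits_const_last_eq_one' (show 1 < b by omega)]
  have hD : ∀ i, (D i : ℕ) ≤ b - 1 := fun i => by have := (D i).2; omega
  refine Summable.tsum_lt_tsum (i := a) (fun i => ?_) ?_ Real.summable_ofDigitsTerm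
    Real.summable_ofDigitsTerm
  · unfold Real.ofDigitsTerm
    have : ((D i : ℕ) : ℝ) ≤ ((b - 1 : ℕ) : ℝ) := by exact_mod_cast hD i
    gcongr
  · unfold Real.ofDigitsTerm
    have : ((D a : ℕ) : ℝ) < ((b - 1 : ℕ) : ℝ) := by
      exact_mod_cast lt_of_le_of_ne (hD a) ha
    have hb0 : (0 : ℝ) < b := by positivity
    gcongr

/-- Infinitely many digits different from $b-1$ make every tail strictly less than $1$, so the floor
reads off exactly the leading digits. -/
lemma digit_ofDigits {b : ℕ} (hb : 2 ≤ b) (D : ℕ → Fin b)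
    (h : ∀ n, ∃ a, n ≤ a ∧ (D a : ℕ) ≠ b - 1) (n : ℕ) :
    digit b (Real.ofDigits D) n = D n := by
  have hb0 : (b : ℝ) ≠ 0 := by positivity
  have h1 : Real.ofDigits (fun i => D (i + (n + 1))) < 1 := by
    refine ofDigits_lt_one hb _ ?_
    obtain ⟨a, ha, ha'⟩ := h (n + 1)
    exact ⟨a - (n + 1), by rwa [Nat.sub_add_cancel ha]⟩
  have h0 := Real.ofDigits_nonneg (fun i => D (i + (n + 1)))
  have key : Real.ofDigits D * (b : ℝ) ^ (n + 1) =
      Real.ofDigits (fun i => D (i + (n + 1))) +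
        ((∑ i ∈ Finset.range (n + 1), (D i : ℕ) * b ^ (n - i) : ℕ) : ℝ) := by
    rw [Real.ofDigits_eq_sum_add_ofDigits D (n + 1), add_mul, mul_right_comm,
      inv_mul_cancel₀ (by positivity), one_mul, add_comm]
    push_cast
    rw [Finset.sum_mul]
    congr 1
    refine Finset.sum_congr rfl fun i hi => ?_
    have hi := Finset.mem_range.1 hi
    rw [Real.ofDigitsTerm, mul_assoc]
    congr 1
    rw [inv_mul_eq_iff_eq_mul₀ (by positivity), ← pow_add]
    congr 1
    omega
  rw [digit, key, Nat.floor_add_natCast h0, Nat.floor_eq_zero.2 h1, zero_add,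
    Finset.sum_range_succ]
  have : b ∣ ∑ i ∈ Finset.range n, (D i : ℕ) * b ^ (n - i) := by
    refine Finset.dvd_sum fun i hi => ?_
    have hi := Finset.mem_range.1 hi
    exact Dvd.dvd.mul_left (dvd_pow_self b (by omega)) _
  obtain ⟨c, hc⟩ := this
  simp only [hc, Nat.sub_self, pow_zero, mul_one, Nat.mul_add_mod]
  exact Nat.mod_eq_of_lt (D n).2

/-- In each residue class modulo `α`, infinitely many digits of `t` differ from `b - 1`. -/
def IsSplittable (b α : ℕ) (t : ℝ) : Prop :=
  ∀ r < α, ∀ n, ∃ a, n ≤ a ∧ digit b t (r + a * α) ≠ b - 1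

/-- The number with the digits of `t` in the residue class `r` modulo `α`. -/
noncomputable def split (b α : ℕ) (hb : 2 ≤ b) (t : ℝ) (r : ℕ) : ℝ :=
  Real.ofDigits (b := b) fun a => ⟨digit b t (r + a * α), digit_lt hb _ _⟩

lemma digit_split {b α : ℕ} (hb : 2 ≤ b) {t : ℝ} (ht : IsSplittable b α t) {r : ℕ} (hr : r < α)
    (a : ℕ) : digit b (split b α hb t r) a = digit b t (r + a * α) :=
  digit_ofDigits hb _ (ht r hr) a

lemma split_nonneg {b α : ℕ} (hb : 2 ≤ b) (t : ℝ) (r : ℕ) : 0 ≤ split b α hb t r :=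
  Real.ofDigits_nonneg _

lemma split_lt_one {b α : ℕ} (hb : 2 ≤ b) {t : ℝ} (ht : IsSplittable b α t) {r : ℕ} (hr : r < α) :
    split b α hb t r < 1 :=
  ofDigits_lt_one hb _ (by obtain ⟨a, -, ha⟩ := ht r hr 0; exact ⟨a, ha⟩)

lemma hasSum_digits {b : ℕ} (hb : 2 ≤ b) {t : ℝ} (ht : t ∈ Set.Ico (0 : ℝ) 1) :
    HasSum (fun p => (digit b t p : ℝ) * digitUnit b p) t := by
  have : NeZero b := ⟨by omega⟩
  exact Real.hasSum_ofDigitsTerm_digits t (by omega) ht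

lemma interlace_split {b α : ℕ} (hb : 2 ≤ b) (hα : 1 ≤ α) {t : ℝ} (ht : t ∈ Set.Ico (0 : ℝ) 1)
    (hs : IsSplittable b α t) : interlace b α (fun r => split b α hb t r) = t := by
  have : NeZero α := ⟨by omega⟩
  have h := hasSum_digits hb ht
  rw [← (Nat.divModEquiv α).symm.hasSum_iff] at h
  have h2 := h.prod_fiberwise (fun a => hasSum_fintype _)
  refine Eq.trans ?_ h2.tsum_eq
  refine tsum_congr fun a => Finset.sum_congr rfl fun r _ => ?_
  rw [digit_split hb hs r.2]
  simp only [Function.comp, Nat.divModEquiv_symm_apply, digitUnit]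
  rw [show a * α + (r : ℕ) = r + a * α by ring, show (r : ℕ) + a * α + 1 = r + 1 + a * α by ring]

/-- The first `n` digits of `t` in the residue class `r` modulo `α`, as an integer. -/
noncomputable def leadDigits (b α : ℕ) (t : ℝ) (r n : ℕ) : ℕ :=
  ∑ k ∈ Finset.range n, digit b t (r + k * α) * b ^ (n - 1 - k)

lemma measurable_leadDigits (b α r n : ℕ) : Measurable fun t => leadDigits b α t r n := by
  unfold leadDigits
  exact Finset.measurable_sum _ fun k _ => (measurable_digit b _).mul_const _

lemma leadDigits_succ (b α : ℕ) (t : ℝ) (r n : ℕ) :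
    leadDigits b α t r (n + 1) = b * leadDigits b α t r n + digit b t (r + n * α) := by
  unfold leadDigits
  rw [Finset.sum_range_succ, Finset.mul_sum]
  simp only [add_tsub_cancel_right, tsub_self, pow_zero, mul_one, add_left_inj]
  refine Finset.sum_congr rfl fun a ha => ?_
  rw [show n - a = n - 1 - a + 1 by have := Finset.mem_range.1 ha; omega, pow_succ]
  ring

lemma leadDigits_div {b : ℕ} (hb : 2 ≤ b) (α : ℕ) (t : ℝ) (r : ℕ) {n : ℕ} (hn : 1 ≤ n) :
    leadDigits b α t r n / b = leadDigits b α t r (n - 1) := by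
  obtain ⟨n, rfl⟩ := Nat.exists_eq_add_of_le' hn
  rw [leadDigits_succ, Nat.mul_add_div (by omega), Nat.div_eq_of_lt (digit_lt hb _ _)]
  simp

lemma leadDigits_lt {b : ℕ} (hb : 2 ≤ b) (α : ℕ) (t : ℝ) (r n : ℕ) :
    leadDigits b α t r n < b ^ n := by
  induction n with
  | zero => simp [leadDigits]
  | succ n ih =>
    rw [leadDigits_succ, pow_succ]
    have := digit_lt hb t (r + n * α)
    calc _ < b * leadDigits b α t r n + b := by omega
      _ = b * (leadDigits b α t r n + 1) := by ring
      _ ≤ b * b ^ n := Nat.mul_le_mul_left _ ih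
      _ = _ := mul_comm _ _

lemma leadDigits_congr {b α : ℕ} {t t' : ℝ} {r n : ℕ}
    (h : ∀ k < n, digit b t (r + k * α) = digit b t' (r + k * α)) :
    leadDigits b α t r n = leadDigits b α t' r n :=
  Finset.sum_congr rfl fun k hk => by rw [h k (Finset.mem_range.1 hk)]

/-- The points of the half-open unit cube with splittable coordinates. -/
def splittableCube (b α : ℕ) (ι : Type*) : Set (ι → ℝ) :=
  {t | ∀ i, t i ∈ Set.Ico (0 : ℝ) 1 ∧ IsSplittable b α (t i)}

/-- For splittable $t$ an explicit preimage under $\mathscr D_\alpha$ is given by `split`, and the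
box containing it is read off from the leading digits of $t$ in each residue class. Other points can
be ignored, as they form a null set. -/
lemma mem_image_interlaceVec {b α : ℕ} (hb : 2 ≤ b) (hα : 1 ≤ α) {ι : Type*} {t : ι → ℝ}
    (ht : t ∈ splittableCube b α ι) (l a : ι → Fin α → ℕ)
    (ha : ∀ i r, a i r = leadDigits b α (t i) r (l i r)) :
    t ∈ interlaceVec b α '' boxSet b α l a := by
  refine ⟨fun i r => split b α hb (t i) r, fun i r => ?_, ?_⟩
  · have hf : ⌊split b α hb (t i) r * (b : ℝ) ^ l i r⌋₊ = a i r := by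
      rw [floor_eq_sum_digits hb (split_lt_one hb (ht i).2 r.2), ha]
      exact Finset.sum_congr rfl fun k _ => by rw [digit_split hb (ht i).2 r.2]
    have hb0 : (0 : ℝ) < (b : ℝ) ^ l i r := by positivity
    have h0 : 0 ≤ split b α hb (t i) r * (b : ℝ) ^ l i r :=
      mul_nonneg (split_nonneg hb _ _) hb0.le
    rw [Nat.floor_eq_iff h0] at hf
    exact ⟨(div_le_iff₀ hb0).2 hf.1, (lt_div_iff₀ hb0).2 hf.2⟩
  · funext i
    exact interlace_split hb hα (ht i).1 (ht i).2

lemma IsSplittable.of_eventually_eq {b α : ℕ} (hα : 1 ≤ α) {t t' : ℝ} (h : IsSplittable b α t)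
    {N : ℕ} (hN : ∀ n, N ≤ n → digit b t' n = digit b t n) : IsSplittable b α t' := by
  intro r hr n
  obtain ⟨a, ha, ha'⟩ := h r hr (max n N)
  refine ⟨a, (le_max_left _ _).trans ha, ?_⟩
  rwa [hN]
  have h1 : N ≤ a := (le_max_right _ _).trans ha
  nlinarith

/-- Lowering the digit at one position `pos m` from $b-1$ to $b-2$ gives infinitely many translates
of the set. They are disjoint, since `pos m` can be recovered as the only position among the `pos`
with a digit different from $b-1$, and all lie in $[0,1)$. Their common measure is therefore $0$. -/
lemma volume_digits_eq_last {b α : ℕ} (hb : 2 ≤ b) (hα : 1 ≤ α) (r n : ℕ) :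
    volume {t : ℝ | t ∈ Set.Ico (0 : ℝ) 1 ∧ ∀ a, n ≤ a → digit b t (r + a * α) = b - 1} = 0 := by
  set B := {t : ℝ | t ∈ Set.Ico (0 : ℝ) 1 ∧ ∀ a, n ≤ a → digit b t (r + a * α) = b - 1} with hB
  have hBm : MeasurableSet B := by
    have : B = Set.Ico (0 : ℝ) 1 ∩ ⋂ a, ⋂ (_ : n ≤ a), {t | digit b t (r + a * α) = b - 1} := by
      ext; simp [hB]
    rw [this]
    exact measurableSet_Ico.inter (MeasurableSet.iInter fun a => MeasurableSet.iInter fun _ =>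
      measurable_digit b _ (measurableSet_singleton _))
  set pos : ℕ → ℕ := fun m => r + (n + m) * α
  have hpos : ∀ m m', m ≠ m' → pos m ≠ pos m' := fun m m' h e => h (by
    have : (n + m) * α = (n + m') * α := by simp only [pos] at e; omega
    have := Nat.eq_of_mul_eq_mul_right (by omega) this
    omega)
  set T : ℕ → Set ℝ := fun m => (fun t => t + digitUnit b (pos m)) ⁻¹' B
  have hT : ∀ m s, s ∈ T m → s ∈ Set.Ico (0 : ℝ) 1 ∧ digit b s (pos m) ≠ b - 1 ∧
      ∀ m', m' ≠ m → digit b s (pos m') = b - 1 := by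
    intro m s hs
    have hs : s + digitUnit b (pos m) ∈ B := hs
    have hd : digit b (s + digitUnit b (pos m)) (pos m) = b - 1 := hs.2 _ (by omega)
    have e : s = (s + digitUnit b (pos m)) + ((-1 : ℤ) : ℝ) * digitUnit b (pos m) := by
      push_cast; ring
    have h0 : 0 ≤ (digit b (s + digitUnit b (pos m)) (pos m) : ℤ) + (-1) := by rw [hd]; omega
    have h1 : (digit b (s + digitUnit b (pos m)) (pos m) : ℤ) + (-1) < b := by rw [hd]; omega
    refine ⟨⟨?_, ?_⟩, ?_, fun m' hm' => ?_⟩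
    · rw [e]; exact add_unit_nonneg hb hs.1.1 h0 h1
    · have := hs.1.2
      have := digitUnit_pos hb (pos m)
      linarith
    · have := digit_add_unit_self hb hs.1.1 h0 h1
      rw [← e, hd] at this
      omega
    · have := digit_add_unit_of_ne hb hs.1.1 h0 h1 (hpos m' m hm')
      rw [← e] at this
      rw [this]
      exact hs.2 _ (by omega)
  have hvol : ∀ m, volume (T m) = volume B := fun m => measure_preimage_add_right _ _ _
  have hdisj : Pairwise (Function.onFun Disjoint T) := by
    intro m m' h
    rw [Function.onFun, Set.disjoint_left]
    intro s hs hs'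
    exact (hT m s hs).2.1 ((hT m' s hs').2.2 m h)
  have hle : volume (⋃ m, T m) ≤ 1 := by
    refine (measure_mono (Set.iUnion_subset fun m s hs => (hT m s hs).1)).trans ?_
    simp
  rw [measure_iUnion hdisj fun m => (measurable_add_const _) hBm] at hle
  simp only [hvol] at hle
  by_contra h
  rw [ENNReal.tsum_const_eq_top_of_ne_zero h] at hle
  simp at hle

lemma ae_isSplittable {b α : ℕ} (hb : 2 ≤ b) (hα : 1 ≤ α) :
    ∀ᵐ t : ℝ, t ∈ Set.Ico (0 : ℝ) 1 → IsSplittable b α t := by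
  have : ∀ᵐ t : ℝ, ∀ r n : ℕ,
      ¬ (t ∈ Set.Ico (0 : ℝ) 1 ∧ ∀ a, n ≤ a → digit b t (r + a * α) = b - 1) := by
    rw [ae_all_iff]; intro r
    rw [ae_all_iff]; intro n
    rw [ae_iff]
    simpa [and_assoc] using volume_digits_eq_last hb hα r n
  filter_upwards [this] with t ht h01 r _ n
  have := ht r n
  push Not at this
  exact this h01

lemma ae_mem_splittableCube {b α : ℕ} (hb : 2 ≤ b) (hα : 1 ≤ α) {ι : Type*} [Fintype ι] :
    ∀ᵐ t : ι → ℝ, (∀ i, t i ∈ Set.Ico (0 : ℝ) 1) → t ∈ splittableCube b α ι := by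
  have : ∀ᵐ t : ι → ℝ, ∀ i, t i ∈ Set.Ico (0 : ℝ) 1 → IsSplittable b α (t i) := by
    rw [ae_all_iff]
    intro i
    exact (Measure.quasiMeasurePreserving_eval (fun _ : ι => (volume : Measure ℝ)) i).ae (ae_isSplittable hb hα)
  filter_upwards [this] with t ht h i
  exact ⟨h i, ht i (h i)⟩

/-! ### Matching digit positions with residue classes -/

/-- Each position in `T` is matched with the first later position in a residue class that is
still available; `U` is the set of classes in use. -/
lemma exists_matching {α q : ℕ} (hα : 1 ≤ α) (hq : q ≤ α) (T : Finset ℕ) :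
    T.card ≤ q → ∃ U ⊆ Finset.range q, ∃ p m : ℕ → ℕ, Set.BijOn p U T ∧
      (∀ r ∈ U, p r ≤ r + m r * α) ∧
      (∀ r ∈ U, ∀ a < m r, r + a * α < p r) ∧
      (∀ r ∈ U, ∀ r' ∈ Finset.range q \ U, ∀ a, r' + a * α < p r ∨ r + m r * α < r' + a * α) ∧
      (∀ r ∈ U, ∀ r' ∈ U, ∀ a < m r', r' + a * α < p r ∨ r + m r * α < r' + a * α) := by
  -- Positions are treated in increasing order. The last two invariants say that the interval from
  -- $p_r$ to its new position avoids every position of an unused class, and in a used class every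
  -- position before the final one. The former is what allows an unused class to be taken later.
  induction T using Finset.induction_on_max with
  | empty => exact fun _ => ⟨∅, by simp, id, id, by simp⟩
  | insert P T hP ih =>
    intro hcard
    have hPT : P ∉ T := fun h => lt_irrefl _ (hP P h)
    rw [Finset.card_insert_of_notMem hPT] at hcard
    obtain ⟨U, hU, p, m, hbij, h1, h2, h3, h4⟩ := ih (by omega)
    have hUc : U.card = T.card := by
      have := hbij.image_eq
      have e : U.image p = T := by exact_mod_cast this
      rw [← e, Finset.card_image_of_injOn hbij.injOn]
    -- Fewer than $q$ classes are in use, so some class below $q$ is free; the greedy choice is the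
    -- first position from $P$ on in such a class.
    have hex : ∃ N, P ≤ N ∧ N % α ∈ Finset.range q \ U := by
      have : (Finset.range q \ U).Nonempty := by
        rw [← Finset.card_pos, Finset.card_sdiff_of_subset hU, Finset.card_range]
        omega
      obtain ⟨r, hr⟩ := this
      have hrq : r < q := by simp at hr; exact hr.1
      refine ⟨r + P * α, by nlinarith, ?_⟩
      rwa [Nat.add_mul_mod_self_right, Nat.mod_eq_of_lt (by omega)]
    classical
    obtain ⟨hN1, hN2⟩ := Nat.find_spec hex
    have hmin := fun n => Nat.find_min hex (m := n)
    set N := Nat.find hex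
    set r₀ := N % α
    have hr₀ : r₀ ∉ U := (Finset.mem_sdiff.1 hN2).2
    have hr₀q : r₀ < q := Finset.mem_range.1 (Finset.mem_sdiff.1 hN2).1
    have hNr : r₀ + N / α * α = N := Nat.mod_add_div' N α
    -- By minimality of $N$, no position of a free class lies in $[P,N)$.
    have hfree : ∀ r ∈ Finset.range q \ U, ∀ a, r + a * α < N → r + a * α < P := by
      intro r hr a ha
      by_contra hc
      refine hmin _ ha ⟨not_lt.1 hc, ?_⟩
      have hrq : r < q := Finset.mem_range.1 (Finset.mem_sdiff.1 hr).1
      rwa [Nat.add_mul_mod_self_right, Nat.mod_eq_of_lt (by omega)]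
    have hpP : ∀ r ∈ U, p r < P := fun r hr => hP _ (hbij.mapsTo hr)
    have hne : ∀ r ∈ U, r ≠ r₀ := fun r hr h => hr₀ (h ▸ hr)
    have hnew : ∀ a < N / α, r₀ + a * α < P := fun a ha => hfree r₀ hN2 a (by
      rw [← hNr]; have := Nat.mul_lt_mul_of_pos_right ha (show 0 < α by omega); omega)
    refine ⟨insert r₀ U, ?_, Function.update p r₀ P, Function.update m r₀ (N / α), ?_, ?_, ?_, ?_,
      ?_⟩
    · exact Finset.insert_subset (Finset.mem_range.2 hr₀q) hU
    · have hb : Set.BijOn (Function.update p r₀ P) U T :=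
        hbij.congr fun r hr => by rw [Function.update_of_ne (hne r hr)]
      have := hb.insert (a := r₀) (by simpa using hPT)
      simpa using this
    · intro r hr
      rcases Finset.mem_insert.1 hr with rfl | hr
      · simp only [Function.update_self]; omega
      · simpa only [Function.update_of_ne (hne r hr)] using h1 r hr
    · intro r hr
      rcases Finset.mem_insert.1 hr with rfl | hr
      · simpa only [Function.update_self] using hnew
      · simpa only [Function.update_of_ne (hne r hr)] using h2 r hr
    · intro r hr r' hr' a
      have hr'U : r' ∈ Finset.range q \ U := by
        simp only [Finset.mem_sdiff, Finset.mem_insert, not_or] at hr' ⊢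
        exact ⟨hr'.1, hr'.2.2⟩
      rcases Finset.mem_insert.1 hr with rfl | hr
      · simp only [Function.update_self]
        by_contra hc
        rw [hNr] at hc
        push Not at hc
        rcases hc.2.lt_or_eq with hlt | heq
        · exact absurd (hfree r' hr'U a hlt) (by omega)
        · have hr'q : r' < q := Finset.mem_range.1 (Finset.mem_sdiff.1 hr'U).1
          have : r₀ = r' := by
            rw [show r₀ = N % α from rfl, ← heq, Nat.add_mul_mod_self_right,
              Nat.mod_eq_of_lt (by omega)]
          exact (Finset.mem_sdiff.1 hr').2 (this ▸ Finset.mem_insert_self _ _)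
      · simpa only [Function.update_of_ne (hne r hr)] using h3 r hr r' hr'U a
    · intro r hr r' hr' a ha
      rcases Finset.mem_insert.1 hr with rfl | hr <;> rcases Finset.mem_insert.1 hr' with rfl | hr'
      · simp only [Function.update_self] at ha ⊢
        exact Or.inl (hnew a ha)
      · simp only [Function.update_self, Function.update_of_ne (hne r' hr')] at ha ⊢
        exact Or.inl ((h2 r' hr' a ha).trans (hpP r' hr'))
      · simp only [Function.update_self, Function.update_of_ne (hne r hr)] at ha ⊢
        exact h3 r hr r₀ hN2 a
      · simp only [Function.update_of_ne (hne r hr), Function.update_of_ne (hne r' hr')] at ha ⊢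
        exact h4 r hr r' hr' a ha

/-- The positions `p r`, `r < q`, can be moved to positions `r + (m r - 1) * α` such that no
position in between has an index less than `m r' - 1` in its class `r'`. -/
structure IsMatching (α q : ℕ) (p m : Fin α → ℕ) : Prop where
  injOn : Set.InjOn p {r | (r : ℕ) < q}
  one_le : ∀ r, 1 ≤ m r
  le : ∀ r : Fin α, (r : ℕ) < q → p r ≤ r + (m r - 1) * α
  avoid : ∀ r : Fin α, (r : ℕ) < q → ∀ r' : Fin α, ∀ a < m r' - 1,
    (r' : ℕ) + a * α < p r ∨ (r : ℕ) + (m r - 1) * α < r' + a * α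

/-- With as many classes as positions, all classes below `T.card` end up in use, which are exactly
the steps occurring in a difference of order `T.card`. -/
lemma exists_isMatching {α : ℕ} (hα : 1 ≤ α) (T : Finset ℕ) (hT : T.card ≤ α) :
    ∃ p m : Fin α → ℕ, IsMatching α T.card p m ∧ Set.BijOn p {r | (r : ℕ) < T.card} T := by
  obtain ⟨U, hU, p, m, hbij, h1, h2, h3, h4⟩ := exists_matching hα hT T le_rfl
  have hUc : U.card = T.card := by
    have e : U.image p = T := by exact_mod_cast hbij.image_eq
    rw [← e, Finset.card_image_of_injOn hbij.injOn]
  have hUe : U = Finset.range T.card := Finset.eq_of_subset_of_card_le hU (by simp [hUc])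
  have hmem : ∀ r, r ∈ U ↔ r < T.card := fun r => by rw [hUe, Finset.mem_range]
  have hb : Set.BijOn (fun r : Fin α => p r) {r | (r : ℕ) < T.card} T := by
    refine ⟨fun r hr => hbij.mapsTo ((hmem r).2 hr), fun r hr r' hr' h => ?_, fun n hn => ?_⟩
    · exact Fin.ext (hbij.injOn ((hmem r).2 hr) ((hmem r').2 hr') h)
    · obtain ⟨r, hr, rfl⟩ := hbij.surjOn hn
      have hr' := (hmem r).1 hr
      exact ⟨⟨r, by omega⟩, hr', rfl⟩
  -- Box levels are at least $1$, hence the shift by one. Classes without a step get level $1$,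
  -- whose parent imposes no condition on digits.
  refine ⟨fun r => p r, fun r => if (r : ℕ) < T.card then m r + 1 else 1,
    ⟨hb.injOn, fun r => by split_ifs <;> omega, fun r hr => ?_, fun r hr r' a ha => ?_⟩, hb⟩
  · simpa [hr] using h1 r ((hmem r).2 hr)
  · by_cases hr' : (r' : ℕ) < T.card
    · simp only [hr', hr, if_true, Nat.add_sub_cancel] at ha ⊢
      exact h4 r ((hmem r).2 hr) r' ((hmem r').2 hr') a ha
    · simp [hr'] at ha

/-- The position of the leading digit of a number with `l` digits in the residue class `r`. -/
def leadPos (d : ℕ) (l : Fin d → ℕ) (r : Fin d) : ℕ := r + (l r - 1) * d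

lemma leadPos_injective (d : ℕ) (l : Fin d → ℕ) : Function.Injective (leadPos d l) := by
  intro r r' h
  have := congrArg (· % d) h
  simp only [leadPos, Nat.add_mul_mod_self_right, Nat.mod_eq_of_lt r.2, Nat.mod_eq_of_lt r'.2]
    at this
  exact Fin.ext this

/-- Identifies the factor with the largest possible change of the leading digit; thus the smallest
factors belong to the last positions. -/
lemma gammaFactor_eq (b d : ℕ) (l : Fin d → ℕ) (r : Fin d) (hr : 0 < l r) :
    gammaFactor b d r (l r) = ((b : ℝ) - 1) * digitUnit b (leadPos d l r) := by
  unfold gammaFactor digitUnit leadPos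
  rw [← zpow_natCast, ← zpow_neg]
  congr 2
  push_cast [Nat.cast_sub (show 1 ≤ l r from hr)]
  ring

lemma digitUnit_injective {b : ℕ} (hb : 2 ≤ b) : Function.Injective (digitUnit b) := by
  intro p p' h
  have h := inv_injective h
  have := pow_right_injective₀ (a := (b : ℝ)) (by positivity) (by
    have : (2 : ℝ) ≤ b := by exact_mod_cast hb
    linarith) h
  omega

lemma gammaFactor_injOn {b : ℕ} (hb : 2 ≤ b) (d : ℕ) (l : Fin d → ℕ) :
    Set.InjOn (fun r : Fin d => gammaFactor b d r (l r)) (support l) := by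
  intro r hr r' hr' h
  simp only [support, Finset.coe_filter, Finset.mem_univ, true_and, Set.mem_ofPred_eq] at hr hr'
  simp only [gammaFactor_eq b d l _ hr, gammaFactor_eq b d l _ hr'] at h
  have hb' : (b : ℝ) - 1 ≠ 0 := by
    have : (2 : ℝ) ≤ b := by exact_mod_cast hb
    linarith
  exact leadPos_injective d l (digitUnit_injective hb (mul_left_cancel₀ hb' h))

/-- The member with the largest factor has all the other members below it, and by definition fewer
than $\alpha$ elements lie below it. The two parts give the orders $1\le A_i\le\alpha$ on the active
coordinates. -/
lemma card_smallest_le {b : ℕ} (hb : 2 ≤ b) (d α : ℕ) (hα : 1 ≤ α) (l : Fin d → ℕ) :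
    (smallest b d α l).card ≤ α ∧ ((support l).Nonempty → (smallest b d α l).Nonempty) := by
  constructor
  · rcases (smallest b d α l).eq_empty_or_nonempty with h | h
    · simp [h]
    obtain ⟨r, hr, hmax⟩ := Finset.exists_max_image _ (fun r : Fin d => gammaFactor b d r (l r)) h
    have hr' := Finset.mem_filter.1 hr
    have hsub : (smallest b d α l).erase r ⊆ (support l).filter fun r' : Fin d =>
        gammaFactor b d r' (l r') < gammaFactor b d r (l r) := by
      intro r' h'
      obtain ⟨hne, h'⟩ := Finset.mem_erase.1 h'
      have hs := (Finset.mem_filter.1 h').1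
      exact Finset.mem_filter.2 ⟨hs, lt_of_le_of_ne (hmax r' h') fun e =>
        hne (gammaFactor_injOn hb d l hs hr'.1 e)⟩
    have := Finset.card_le_card hsub
    rw [Finset.card_erase_of_mem hr] at this
    omega
  · intro h
    obtain ⟨r, hr, hmin⟩ := Finset.exists_min_image _ (fun r : Fin d => gammaFactor b d r (l r)) h
    refine ⟨r, Finset.mem_filter.2 ⟨hr, ?_⟩⟩
    rw [Finset.card_eq_zero.2]
    · omega
    · exact Finset.filter_eq_empty_iff.2 fun r' hr' => not_lt.2 (hmin r' hr')

/-! ### Mixed differences -/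

section MixedDifference

variable {κ E : Type*}

/-- The mixed difference of `f` at `t` with steps `e`. -/
def mixedDiff [Fintype κ] [AddCommGroup E] (f : E → ℝ) (t : E) (e : κ → E) : ℝ :=
  ∑ v : Finset κ, (-1) ^ v.card * f (t + ∑ θ ∈ v, e θ)

/-- Linear extension of `f` to formal combinations of points. -/
noncomputable def evalCombination (f : E → ℝ) : AddMonoidAlgebra ℝ E →ₗ[ℝ] ℝ :=
  Finsupp.linearCombination ℝ f ∘ₗ (AddMonoidAlgebra.coeffLinearEquiv ℝ).toLinearMap

lemma evalCombination_single (f : E → ℝ) (t : E) (c : ℝ) :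
    evalCombination f (AddMonoidAlgebra.single t c) = c * f t := by
  simp [evalCombination, AddMonoidAlgebra.coeff_single]

lemma prod_single_one [AddCommGroup E] (e : κ → E) (v : Finset κ) :
    ∏ θ ∈ v, AddMonoidAlgebra.single (e θ) (1 : ℝ) =
      AddMonoidAlgebra.single (∑ θ ∈ v, e θ) (1 : ℝ) := by
  classical
  induction v using Finset.induction_on with
  | empty => simp [AddMonoidAlgebra.one_def]
  | insert θ v h ih =>
    rw [Finset.prod_insert h, Finset.sum_insert h, ih, AddMonoidAlgebra.single_mul_single, one_mul]

/-- In the group algebra of the points a mixed difference is the product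
$\prod_\theta(1-X^{e_\theta})$, so identities between differences become polynomial identities. -/
lemma mixedDiff_eq [Fintype κ] [AddCommGroup E] (f : E → ℝ) (t : E) (e : κ → E) :
    mixedDiff f t e = evalCombination f (AddMonoidAlgebra.single t 1 *
      ∏ θ, (1 - AddMonoidAlgebra.single (e θ) 1)) := by
  classical
  rw [Finset.prod_sub, Finset.mul_sum, map_sum, Finset.powerset_univ]
  refine Finset.sum_congr rfl fun v _ => ?_
  have hsign : (-1 : AddMonoidAlgebra ℝ E) ^ v.card =
      algebraMap ℝ (AddMonoidAlgebra ℝ E) ((-1) ^ v.card) := by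
    rw [map_pow, map_neg, map_one]
  rw [prod_single_one, Finset.prod_const_one, mul_one, mul_left_comm,
    AddMonoidAlgebra.single_mul_single, one_mul, hsign, ← Algebra.smul_def, map_smul,
    evalCombination_single, one_mul, smul_eq_mul]

/-- Telescoping of a mixed difference with large steps. -/
lemma mixedDiff_nsmul [Fintype κ] [DecidableEq κ] [AddCommGroup E]
    (f : E → ℝ) (t : E) (e : κ → E) (n : κ → ℕ) :
    mixedDiff f t (fun θ => n θ • e θ) =
      ∑ h ∈ Fintype.piFinset fun θ => Finset.range (n θ),
        mixedDiff f (t + ∑ θ, h θ • e θ) e := by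
  -- Apply $1-y^n=(1-y)\sum_{h<n}y^h$ in each factor.
  have key : ∏ θ, (1 - AddMonoidAlgebra.single (n θ • e θ) (1 : ℝ)) =
      (∏ θ, (1 - AddMonoidAlgebra.single (e θ) (1 : ℝ))) *
        ∑ h ∈ Fintype.piFinset fun θ => Finset.range (n θ),
          AddMonoidAlgebra.single (∑ θ, h θ • e θ) (1 : ℝ) := by
    have : ∀ h : κ → ℕ, AddMonoidAlgebra.single (∑ θ, h θ • e θ) (1 : ℝ) =
        ∏ θ, AddMonoidAlgebra.single (e θ) (1 : ℝ) ^ h θ := fun h => by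
      rw [← prod_single_one]
      simp [AddMonoidAlgebra.single_pow]
    simp only [this]
    rw [← Finset.prod_univ_sum, ← Finset.prod_mul_distrib]
    refine Finset.prod_congr rfl fun θ _ => ?_
    rw [mul_neg_geom_sum, AddMonoidAlgebra.single_pow, one_pow]
  rw [mixedDiff_eq, key, Finset.mul_sum, Finset.mul_sum, map_sum]
  refine Finset.sum_congr rfl fun h _ => ?_
  rw [mixedDiff_eq, mul_left_comm, mul_comm, mul_comm (AddMonoidAlgebra.single t (1 : ℝ)),
    mul_assoc, ← mul_assoc, AddMonoidAlgebra.single_mul_single, one_mul, add_comm]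

/-- Cauchy–Schwarz for the telescoped sum, which has $\prod_\theta n_\theta$ terms. -/
lemma mixedDiff_nsmul_sq_le [Fintype κ] [DecidableEq κ] [AddCommGroup E]
    (f : E → ℝ) (t : E) (e : κ → E) (n : κ → ℕ) :
    mixedDiff f t (fun θ => n θ • e θ) ^ 2 ≤ (∏ θ, (n θ : ℝ)) *
      ∑ h ∈ Fintype.piFinset fun θ => Finset.range (n θ),
        mixedDiff f (t + ∑ θ, h θ • e θ) e ^ 2 := by
  rw [mixedDiff_nsmul]
  refine sq_sum_le_card_mul_sum_sq.trans_eq ?_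
  simp

end MixedDifference

/-- The index set of the steps of a difference of order `A`. -/
abbrev StepIdx {ι : Type*} (α : ℕ) (A : ι → ℕ) : Type _ :=
  {θ : ι × Fin α // (θ.2 : ℕ) < A θ.1}

section StepIdx

variable {ι : Type*} [Fintype ι] [DecidableEq ι]

/-- Translates families $(v_i)_i$ into subsets of one flat index type, where mixed differences are
products. -/
lemma sum_stepIdx {M : Type*} [AddCommMonoid M] {α : ℕ} (A : ι → ℕ) (v : ι → Finset (Fin α))
    (hv : v ∈ subsets α A) (φ : ι → Fin α → M) :
    ∑ θ : StepIdx α A with θ.1.2 ∈ v θ.1.1, φ θ.1.1 θ.1.2 = ∑ i, ∑ r ∈ v i, φ i r := by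
  have h1 : ∑ i, ∑ r ∈ v i, φ i r =
      ∑ x ∈ (Finset.univ : Finset (ι × Fin α)).filter fun x => x.2 ∈ v x.1, φ x.1 x.2 := by
    rw [Finset.sum_filter, Fintype.sum_prod_type]
    refine Finset.sum_congr rfl fun i _ => ?_
    rw [← Finset.sum_filter]
    simp
  rw [h1]
  refine Finset.sum_bij (fun θ _ => θ.1) (fun θ hθ => by simpa using hθ)
    (fun _ _ _ _ h => Subtype.ext h) (fun x hx => ?_) (fun _ _ => rfl)
  simp only [Finset.mem_filter, Finset.mem_univ, true_and] at hx
  have := Fintype.mem_piFinset.1 hv x.1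
  have := Finset.mem_powerset.1 this hx
  exact ⟨⟨x, by simpa [firstIdx] using this⟩, by simpa using hx, rfl⟩

lemma prod_stepIdx {M : Type*} [CommMonoid M] {α : ℕ} (A : ι → ℕ) (φ : ι → Fin α → M) :
    ∏ θ : StepIdx α A, φ θ.1.1 θ.1.2 = ∏ i, ∏ r ∈ firstIdx α A i, φ i r := by
  have h := sum_stepIdx (M := Additive M) A (fun i => firstIdx α A i)
    (Fintype.mem_piFinset.2 fun i => Finset.mem_powerset_self _) (fun i r => Additive.ofMul (φ i r))
  rw [Finset.filter_true_of_mem fun θ _ => by simpa [firstIdx] using θ.2] at h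
  exact h

lemma difference_eq_mixedDiff {α : ℕ} (A : ι → ℕ) (t : ι → ℝ) (z : ι → Fin α → ℝ)
    (f : (ι → ℝ) → ℝ) :
    difference A t z f =
      mixedDiff f t fun θ : StepIdx α A => Pi.single θ.1.1 (z θ.1.1 θ.1.2) := by
  unfold difference mixedDiff
  refine Finset.sum_bij' (fun v _ => Finset.univ.filter fun θ : StepIdx α A => θ.1.2 ∈ v θ.1.1)
    (fun V _ i => Finset.univ.filter fun r => ∃ h : (r : ℕ) < A i, ⟨(i, r), h⟩ ∈ V)
    (fun _ _ => Finset.mem_univ _) (fun V _ => ?_) (fun v hv => ?_) (fun V _ => ?_)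
    (fun v hv => ?_)
  · refine Fintype.mem_piFinset.2 fun i => Finset.mem_powerset.2 fun r hr => ?_
    obtain ⟨h, -⟩ := (Finset.mem_filter.1 hr).2
    simpa [firstIdx] using h
  · funext i
    ext r
    simp only [Finset.mem_filter, Finset.mem_univ, true_and, exists_prop, and_iff_right_iff_imp]
    intro hr
    have := Finset.mem_powerset.1 (Fintype.mem_piFinset.1 hv i) hr
    simpa [firstIdx] using this
  · ext θ
    simp only [Finset.mem_filter, Finset.mem_univ, true_and]
    exact ⟨fun ⟨_, h⟩ => h, fun h => ⟨θ.2, h⟩⟩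
  · congr 2
    · rw [Finset.card_eq_sum_ones, sum_stepIdx A v hv (fun _ _ => 1)]
      simp
    · rw [sum_stepIdx A v hv (fun i r => Pi.single i (z i r))]
      funext i
      simp [shifted, Finset.sum_apply, Pi.single_apply]

end StepIdx

/-! ### The uniform grid of boxes -/

/-- The half-open unit cube. -/
def unitCube (ι : Type*) : Set (ι → ℝ) := Set.univ.pi fun _ => Set.Ico (0 : ℝ) 1

lemma mem_unitCube {ι : Type*} {x : ι → ℝ} : x ∈ unitCube ι ↔ ∀ i, x i ∈ Set.Ico (0 : ℝ) 1 := by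
  simp [unitCube]

section Grid

variable {ι : Type*}

lemma measurableSet_unitCube [Fintype ι] : MeasurableSet (unitCube ι) :=
  MeasurableSet.univ_pi fun _ => measurableSet_Ico

/-- The box of side lengths `b ^ (-m)` with index `a`. -/
def gridBox {b α : ℕ} {m : ι → Fin α → ℕ} (hm : ∀ i r, 1 ≤ m i r)
    (a : ∀ i r, Fin (b ^ m i r)) : Box b α ι :=
  ⟨m, fun i r => a i r, hm, fun i r => (a i r).2⟩

lemma gridBox_injective {b α : ℕ} {m : ι → Fin α → ℕ} (hm : ∀ i r, 1 ≤ m i r) :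
    Function.Injective (gridBox (b := b) hm) := by
  intro a a' h
  have h := congrArg Box.a h
  funext i r
  exact Fin.ext (congrFun (congrFun h i) r)

/-- The index of the box containing the point with interlaced image `t`. -/
noncomputable def gridIndex {b : ℕ} (hb : 2 ≤ b) {α : ℕ} (m : ι → Fin α → ℕ) (t : ι → ℝ) :
    ∀ i r, Fin (b ^ m i r) :=
  fun i r => ⟨leadDigits b α (t i) r (m i r), leadDigits_lt hb _ _ _ _⟩

lemma measurable_gridIndex {b : ℕ} (hb : 2 ≤ b) {α : ℕ} (m : ι → Fin α → ℕ) :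
    Measurable (gridIndex hb m) := by
  refine measurable_pi_lambda _ fun i => measurable_pi_lambda _ fun r => ?_
  refine measurable_to_countable' fun k => ?_
  have : (fun t : ι → ℝ => gridIndex hb m t i r) ⁻¹' {k} =
      (fun t : ι → ℝ => leadDigits b α (t i) r (m i r)) ⁻¹' {(k : ℕ)} := by
    ext t
    simp [gridIndex, Fin.ext_iff]
  rw [this]
  exact ((measurable_leadDigits b α r _).comp (measurable_pi_apply i)) (measurableSet_singleton _)

lemma mem_toSet_gridBox {b : ℕ} (hb : 2 ≤ b) {α : ℕ} {m : ι → Fin α → ℕ}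
    (hm : ∀ i r, 1 ≤ m i r) (a : ∀ i r, Fin (b ^ m i r)) (x : ι → Fin α → ℝ) :
    x ∈ (gridBox hm a).toSet ↔
      ∀ i r, 0 ≤ x i r ∧ ⌊x i r * (b : ℝ) ^ m i r⌋₊ = a i r := by
  refine forall_congr' fun i => forall_congr' fun r => ?_
  have hb0 : (0 : ℝ) < (b : ℝ) ^ m i r := by positivity
  change ((a i r : ℕ) : ℝ) / (b : ℝ) ^ m i r ≤ _ ∧ _ < (((a i r : ℕ) : ℝ) + 1) / (b : ℝ) ^ m i r ↔ _
  rw [div_le_iff₀ hb0, lt_div_iff₀ hb0]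
  constructor
  · intro h
    have h0 : 0 ≤ x i r * (b : ℝ) ^ m i r := (Nat.cast_nonneg _).trans h.1
    exact ⟨nonneg_of_mul_nonneg_left h0 hb0, (Nat.floor_eq_iff h0).2 h⟩
  · rintro ⟨h0, h⟩
    exact (Nat.floor_eq_iff (mul_nonneg h0 hb0.le)).1 h

open Classical in
/-- The partition into all boxes of side lengths `b ^ (-m)`. -/
noncomputable def gridPartition [Fintype ι] (b : ℕ) {α : ℕ} {m : ι → Fin α → ℕ} (hm : ∀ i r, 1 ≤ m i r) :
    Finset (Box b α ι) :=
  Finset.univ.image (gridBox (b := b) hm)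

lemma isPartition_gridPartition [Fintype ι] {b : ℕ} (hb : 2 ≤ b) {α : ℕ} {m : ι → Fin α → ℕ}
    (hm : ∀ i r, 1 ≤ m i r) : IsPartition (gridPartition b hm) := by
  classical
  constructor
  · intro J hJ J' hJ' hne
    obtain ⟨a, -, rfl⟩ := Finset.mem_image.1 (Finset.mem_coe.1 hJ)
    obtain ⟨a', -, rfl⟩ := Finset.mem_image.1 (Finset.mem_coe.1 hJ')
    rw [Function.onFun, Set.disjoint_left]
    intro x hx hx'
    rw [mem_toSet_gridBox hb] at hx hx'
    refine hne (congrArg _ ?_)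
    funext i r
    exact Fin.ext ((hx i r).2.symm.trans (hx' i r).2)
  · ext x
    simp only [gridPartition, Set.mem_iUnion, Finset.mem_image, Finset.mem_univ, true_and,
      exists_prop, exists_exists_eq_and, Set.mem_ofPred_eq, mem_toSet_gridBox hb]
    constructor
    · rintro ⟨a, h⟩ i r
      refine ⟨(h i r).1, ?_⟩
      have hb0 : (0 : ℝ) < (b : ℝ) ^ m i r := by positivity
      have h1 := Nat.lt_floor_add_one (x i r * (b : ℝ) ^ m i r)
      rw [(h i r).2] at h1
      have h2 : ((a i r : ℕ) : ℝ) + 1 ≤ (b : ℝ) ^ m i r := by exact_mod_cast (a i r).2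
      by_contra hc
      nlinarith
    · intro h
      refine ⟨fun i r => ⟨⌊x i r * (b : ℝ) ^ m i r⌋₊, ?_⟩, fun i r => ⟨(h i r).1, rfl⟩⟩
      have hb0 : (0 : ℝ) < (b : ℝ) ^ m i r := by positivity
      rw [Nat.floor_lt (mul_nonneg (h i r).1 hb0.le)]
      push_cast
      nlinarith [(h i r).2]

/-- The integrand is constant on each set of points with a given grid index, and almost all of that
set lies in $\mathscr D_\alpha$ of the corresponding box. So the integral is at most the sum for the
grid partition in the definition of the variation. The volumes of the images are only bounded below,
so their measurability plays no role. -/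
lemma lintegral_boxSup_le [Fintype ι] [DecidableEq ι] {b : ℕ} (hb : 2 ≤ b) {α : ℕ} (hα : 1 ≤ α)
    {m : ι → Fin α → ℕ} (hm : ∀ i r, 1 ≤ m i r) (A : ι → ℕ) (f : (ι → ℝ) → ℝ) :
    ∫⁻ t in unitCube ι, boxSup A f (gridBox hm (gridIndex hb m t)) ≤
      vitaliVariation b α A f ^ 2 := by
  classical
  have h1 : ∑ J ∈ gridPartition b hm, volume (interlaceVec b α '' J.toSet) * boxSup A f J ≤
      vitaliVariation b α A f ^ 2 := by
    have : (∑ J ∈ gridPartition b hm, volume (interlaceVec b α '' J.toSet) * boxSup A f J) ^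
        (1 / 2 : ℝ) ≤ vitaliVariation b α A f :=
      le_iSup₂_of_le (gridPartition b hm) (isPartition_gridPartition hb hm) le_rfl
    calc _ = ((∑ J ∈ gridPartition b hm, volume (interlaceVec b α '' J.toSet) * boxSup A f J) ^
          (1 / 2 : ℝ)) ^ 2 := by
          rw [← ENNReal.rpow_natCast, ← ENNReal.rpow_mul]
          norm_num
      _ ≤ _ := by gcongr
  refine le_trans ?_ h1
  have hF : Measurable fun a : ∀ i r, Fin (b ^ m i r) => boxSup A f (gridBox hm a) :=
    Measurable.of_discrete
  rw [← lintegral_map hF (measurable_gridIndex hb m), lintegral_fintype, gridPartition,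
    Finset.sum_image fun _ _ _ _ h => gridBox_injective hm h]
  have key : ∀ a, boxSup A f (gridBox hm a) *
      (Measure.map (gridIndex hb m) (volume.restrict (unitCube ι))) {a} ≤
      volume (interlaceVec b α '' (gridBox hm a).toSet) * boxSup A f (gridBox hm a) := by
    intro a
    rw [mul_comm]
    gcongr
    rw [Measure.map_apply (measurable_gridIndex hb m) (measurableSet_singleton _),
      Measure.restrict_apply (measurable_gridIndex hb m (measurableSet_singleton _))]
    refine measure_mono_ae ?_
    filter_upwards [ae_mem_splittableCube hb hα] with t ht hta
    refine mem_image_interlaceVec hb hα (ht (mem_unitCube.1 hta.2)) _ _ fun i r => ?_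
    exact congrArg Fin.val (congrFun (congrFun hta.1 i) r).symm
  convert Finset.sum_le_sum (s := Finset.univ) fun a _ => key a

end Grid

/-! ### Mixed differences with respect to digits -/

section ChangeSet

variable {κ ι : Type*}

/-- The points of the unit cube whose digit at position `p θ` of the coordinate `j θ` can be
changed by `τ θ` without carry, for every `θ`. -/
def changeSet (b : ℕ) (j : κ → ι) (p : κ → ℕ) (τ : κ → ℤ) : Set (ι → ℝ) :=
  {x ∈ unitCube ι | ∀ θ, 0 ≤ (digit b (x (j θ)) (p θ) : ℤ) + τ θ ∧
    (digit b (x (j θ)) (p θ) : ℤ) + τ θ < b}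

lemma measurableSet_changeSet [Fintype ι] [Finite κ] (b : ℕ) (j : κ → ι) (p : κ → ℕ) (τ : κ → ℤ) :
    MeasurableSet (changeSet b j p τ) := by
  have h : ∀ θ, Measurable fun x : ι → ℝ => digit b (x (j θ)) (p θ) := fun θ =>
    (measurable_digit b (p θ)).comp (measurable_pi_apply (j θ))
  have : changeSet b j p τ = unitCube ι ∩ ⋂ θ, (fun x : ι → ℝ => digit b (x (j θ)) (p θ)) ⁻¹'
      {n : ℕ | 0 ≤ (n : ℤ) + τ θ ∧ (n : ℤ) + τ θ < b} := by
    ext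
    simp [changeSet]
  rw [this]
  exact measurableSet_unitCube.inter (MeasurableSet.iInter fun θ => h θ (Set.to_countable _).measurableSet)

variable [DecidableEq ι]

/-- The steps that change the digit at position `p θ` of the coordinate `j θ` by `τ θ`. -/
noncomputable def digitSteps (b : ℕ) (j : κ → ι) (p : κ → ℕ) (τ : κ → ℤ) (θ : κ) : ι → ℝ :=
  Pi.single (j θ) (τ θ * digitUnit b (p θ))

lemma digitUnit_eq_pow_mul {b : ℕ} (hb : 2 ≤ b) {p p' : ℕ} (h : p ≤ p') :
    digitUnit b p = (b : ℝ) ^ (p' - p) * digitUnit b p' := by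
  unfold digitUnit
  rw [eq_mul_inv_iff_mul_eq₀ (by positivity), inv_mul_eq_iff_eq_mul₀ (by positivity), ← pow_add]
  congr 1
  omega

lemma sign_mul_mem_Icc {τ : ℤ} {k B : ℕ} (hk : k ≤ τ.natAbs * B) :
    min 0 τ * B ≤ k * τ.sign ∧ k * τ.sign ≤ max 0 τ * B := by
  have hk' : (k : ℤ) ≤ |τ| * B := by rw [← Int.natCast_natAbs]; exact_mod_cast hk
  rcases lt_trichotomy τ 0 with h | rfl | h
  · rw [abs_of_neg h] at hk'
    rw [Int.sign_eq_neg_one_of_neg h, min_eq_right h.le, max_eq_left h.le]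
    constructor <;> linarith
  · simp
  · rw [abs_of_pos h] at hk'
    rw [Int.sign_eq_one_of_pos h, min_eq_left h.le, max_eq_right h.le]
    constructor <;> linarith

/-- A change by $\tau$ at $p$ is a walk of $|\tau|b^{p'-p}$ unit changes at $p'$, all in the
direction of the sign of $\tau$; this is the form to be telescoped. -/
lemma digitSteps_eq_nsmul {b : ℕ} (hb : 2 ≤ b) {j : κ → ι} {p p' : κ → ℕ}
    (hpp : ∀ θ, p θ ≤ p' θ) (τ : κ → ℤ) :
    digitSteps b j p τ = fun θ => ((τ θ).natAbs * b ^ (p' θ - p θ)) •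
      digitSteps b j p' (fun θ => (τ θ).sign) θ := by
  funext θ
  have : (τ θ : ℝ) = (τ θ).natAbs * ((τ θ).sign : ℝ) := by
    have h : τ θ = (τ θ).natAbs * (τ θ).sign := by
      rw [mul_comm, Int.sign_mul_natAbs]
    rw [← Int.cast_natCast (R := ℝ) (τ θ).natAbs, ← Int.cast_mul, ← h]
  rw [digitSteps, digitSteps, ← Pi.single_smul', digitUnit_eq_pow_mul hb (hpp θ), nsmul_eq_mul]
  congr 1
  rw [this]
  push_cast
  ring

variable [Fintype κ]

lemma add_sum_nsmul_apply (b : ℕ) (j : κ → ι) (p' : κ → ℕ) (σ : κ → ℤ) (k : κ → ℕ)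
    (x : ι → ℝ) (i : ι) :
    (x + ∑ θ, k θ • digitSteps b j p' σ θ) i =
      x i + ∑ θ with j θ = i, ((k θ * σ θ : ℤ) : ℝ) * digitUnit b (p' θ) := by
  rw [Pi.add_apply, Finset.sum_apply, Finset.sum_filter]
  congr 1
  refine Finset.sum_congr rfl fun θ _ => ?_
  simp only [digitSteps, Pi.smul_apply, Pi.single_apply, eq_comm (a := i)]
  split_ifs
  · push_cast
    rw [nsmul_eq_mul, mul_assoc]
  · simp

/-- Small steps on the way between two points that differ in the digits at positions `p` stay in
the unit cube and only affect the digits at positions between `p` and `p'`. -/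
lemma digits_of_small_steps {b : ℕ} (hb : 2 ≤ b) {j : κ → ι} {p p' : κ → ℕ}
    (hinj : ∀ θ θ', j θ = j θ' → p θ = p θ' → θ = θ') (hpp : ∀ θ, p θ ≤ p' θ) {τ : κ → ℤ}
    {x : ι → ℝ} (hx : x ∈ changeSet b j p τ) {k : κ → ℕ}
    (hk : ∀ θ, k θ ≤ (τ θ).natAbs * b ^ (p' θ - p θ)) (i : ι) :
    (x + ∑ θ, k θ • digitSteps b j p' (fun θ => (τ θ).sign) θ) i ∈ Set.Ico (0 : ℝ) 1 ∧
    ∀ n, (∀ θ, j θ = i → n < p θ ∨ p' θ < n) →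
      digit b ((x + ∑ θ, k θ • digitSteps b j p' (fun θ => (τ θ).sign) θ) i) n =
        digit b (x i) n := by
  have hxi := mem_unitCube.1 hx.1 i
  have hR : ∀ θ ∈ Finset.univ.filter (fun θ => j θ = i), j θ = i := fun θ h =>
    (Finset.mem_filter.1 h).2
  have hp : Set.InjOn p (Finset.univ.filter fun θ => j θ = i) := fun θ h θ' h' e =>
    hinj θ θ' ((hR θ h).trans (hR θ' h').symm) e
  have h0 : ∀ θ ∈ Finset.univ.filter (fun θ => j θ = i), 0 ≤ (digit b (x i) (p θ) : ℤ) + τ θ :=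
    fun θ h => hR θ h ▸ (hx.2 θ).1
  have h1 : ∀ θ ∈ Finset.univ.filter (fun θ => j θ = i), (digit b (x i) (p θ) : ℤ) + τ θ < b :=
    fun θ h => hR θ h ▸ (hx.2 θ).2
  have hs0 : ∀ θ ∈ Finset.univ.filter (fun θ => j θ = i),
      ((min 0 (τ θ) : ℤ) : ℝ) * digitUnit b (p θ) ≤
        ((k θ * (τ θ).sign : ℤ) : ℝ) * digitUnit b (p' θ) := fun θ _ => by
    rw [digitUnit_eq_pow_mul hb (hpp θ), ← mul_assoc]
    have := (sign_mul_mem_Icc (hk θ)).1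
    refine mul_le_mul_of_nonneg_right ?_ (digitUnit_pos hb _).le
    exact_mod_cast this
  have hs1 : ∀ θ ∈ Finset.univ.filter (fun θ => j θ = i),
      ((k θ * (τ θ).sign : ℤ) : ℝ) * digitUnit b (p' θ) ≤
        ((max 0 (τ θ) : ℤ) : ℝ) * digitUnit b (p θ) := fun θ _ => by
    rw [digitUnit_eq_pow_mul hb (hpp θ), ← mul_assoc]
    have := (sign_mul_mem_Icc (hk θ)).2
    refine mul_le_mul_of_nonneg_right ?_ (digitUnit_pos hb _).le
    exact_mod_cast this
  rw [add_sum_nsmul_apply]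
  refine ⟨?_, fun n hn => digit_add_dominated hb hxi.1 _ p p' τ hp h0 h1 _ hs0 hs1 fun θ h =>
    hn θ (hR θ h)⟩
  have := floor_add_dominated hb hxi.1 _ p τ hp h0 h1 _ hs0 hs1 (n := 0) fun _ _ => Nat.zero_le _
  simp only [pow_zero, mul_one] at this
  rw [Int.floor_eq_zero_iff.2 hxi] at this
  exact Int.floor_eq_zero_iff.1 this

end ChangeSet

/-! ### Integrals of differences with fixed digit changes. -/

section Estimate

lemma step_gridBox {ι : Type*} {b α : ℕ} {m : ι → Fin α → ℕ} (hm : ∀ i r, 1 ≤ m i r) (a : ∀ i r, Fin (b ^ m i r))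
    (σ : ι → Fin α → ℤ) (i : ι) (r : Fin α) :
    (gridBox hm a).step σ i r = σ i r * digitUnit b (r + (m i r - 1) * α) := by
  simp only [Box.step, gridBox, digitUnit]
  rw [← zpow_natCast, ← zpow_neg]
  congr 2
  push_cast [Nat.cast_sub (hm i r)]
  ring

variable {ι : Type*} [Fintype ι] [DecidableEq ι] {b α : ℕ} {A : ι → ℕ} {p m : ι → Fin α → ℕ}

/-- Only finitely many digits change along the walk, so splittability survives. By
`IsMatching.avoid` the first $m-1$ digits in each class do not change, so the walk stays in the
image of the parent box of $x$. -/
lemma splittable_of_small_steps (hb : 2 ≤ b) (hα : 1 ≤ α)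
    (hM : ∀ i, IsMatching α (A i) (p i) (m i)) {τ : StepIdx α A → ℤ} {x : ι → ℝ}
    (hx : x ∈ changeSet b (fun θ : StepIdx α A => θ.1.1) (fun θ => p θ.1.1 θ.1.2) τ)
    (hxs : x ∈ splittableCube b α ι) {k : StepIdx α A → ℕ}
    (hk : ∀ θ : StepIdx α A, k θ ≤ (τ θ).natAbs *
      b ^ (θ.1.2 + (m θ.1.1 θ.1.2 - 1) * α - p θ.1.1 θ.1.2)) :
    (x + ∑ θ, k θ • digitSteps b (fun θ : StepIdx α A => θ.1.1)
      (fun θ => θ.1.2 + (m θ.1.1 θ.1.2 - 1) * α) (fun θ => (τ θ).sign) θ) ∈ splittableCube b α ι ∧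
    ∀ (i : ι) (r : Fin α), leadDigits b α ((x + ∑ θ, k θ • digitSteps b
      (fun θ : StepIdx α A => θ.1.1) (fun θ => θ.1.2 + (m θ.1.1 θ.1.2 - 1) * α)
      (fun θ => (τ θ).sign) θ) i) r (m i r - 1) = leadDigits b α (x i) r (m i r - 1) := by
  have hinj : ∀ θ θ' : StepIdx α A, θ.1.1 = θ'.1.1 → p θ.1.1 θ.1.2 = p θ'.1.1 θ'.1.2 → θ = θ' := by
    rintro ⟨⟨i, r⟩, h⟩ ⟨⟨i', r'⟩, h'⟩ (rfl : i = i') e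
    have := (hM i).injOn h h' e
    simp_all
  have key := digits_of_small_steps hb (p' := fun θ : StepIdx α A =>
    θ.1.2 + (m θ.1.1 θ.1.2 - 1) * α) hinj (fun θ => (hM θ.1.1).le θ.1.2 θ.2) hx hk
  refine ⟨fun i => ⟨(key i).1, ?_⟩, fun i r => leadDigits_congr fun a ha => (key i).2 _ ?_⟩
  -- The sum of all new positions is a crude common bound for them.
  · refine (hxs i).2.of_eventually_eq hα (N := (∑ θ : StepIdx α A,
      (θ.1.2 + (m θ.1.1 θ.1.2 - 1) * α)) + 1) fun n hn => (key i).2 n fun θ _ => Or.inr ?_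
    have : (θ.1.2 : ℕ) + (m θ.1.1 θ.1.2 - 1) * α ≤ ∑ θ : StepIdx α A,
      (θ.1.2 + (m θ.1.1 θ.1.2 - 1) * α) := Finset.single_le_sum
        (f := fun θ : StepIdx α A => (θ.1.2 : ℕ) + (m θ.1.1 θ.1.2 - 1) * α)
        (fun _ _ => Nat.zero_le _) (Finset.mem_univ θ)
    omega
  · rintro ⟨⟨i', r'⟩, h⟩ (rfl : i' = i)
    exact (hM i').avoid r' h r a ha

/-- The mixed difference with small steps is controlled by the supremum over its box. -/
lemma mixedDiff_small_steps_le (hb : 2 ≤ b) (hα : 1 ≤ α)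
    (hM : ∀ i, IsMatching α (A i) (p i) (m i)) {τ : StepIdx α A → ℤ} (hτ : ∀ θ, τ θ ≠ 0)
    {x : ι → ℝ}
    (hx : x ∈ changeSet b (fun θ : StepIdx α A => θ.1.1) (fun θ => p θ.1.1 θ.1.2) τ)
    (hxs : x ∈ splittableCube b α ι) {h : StepIdx α A → ℕ}
    (hh : ∀ θ : StepIdx α A, h θ < (τ θ).natAbs *
      b ^ (θ.1.2 + (m θ.1.1 θ.1.2 - 1) * α - p θ.1.1 θ.1.2)) (f : (ι → ℝ) → ℝ) :
    ENNReal.ofReal (mixedDiff f (x + ∑ θ, h θ • digitSteps b (fun θ : StepIdx α A => θ.1.1)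
        (fun θ => θ.1.2 + (m θ.1.1 θ.1.2 - 1) * α) (fun θ => (τ θ).sign) θ)
      (digitSteps b (fun θ : StepIdx α A => θ.1.1)
        (fun θ => θ.1.2 + (m θ.1.1 θ.1.2 - 1) * α) (fun θ => (τ θ).sign)) ^ 2) ≤
    ENNReal.ofReal ((∏ θ : StepIdx α A, digitUnit b (θ.1.2 + (m θ.1.1 θ.1.2 - 1) * α)) ^ 2) *
      boxSup A f (gridBox (fun i r => (hM i).one_le r) (gridIndex hb m
        (x + ∑ θ, h θ • digitSteps b (fun θ : StepIdx α A => θ.1.1)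
        (fun θ => θ.1.2 + (m θ.1.1 θ.1.2 - 1) * α) (fun θ => (τ θ).sign) θ))) := by
  set e := digitSteps b (fun θ : StepIdx α A => θ.1.1)
    (fun θ => θ.1.2 + (m θ.1.1 θ.1.2 - 1) * α) (fun θ => (τ θ).sign) with he
  set y := x + ∑ θ, h θ • e θ with hy
  have hm : ∀ i r, 1 ≤ m i r := fun i r => (hM i).one_le r
  set J := gridBox hm (gridIndex hb m y) with hJ
  -- In the notation of the variation the small steps have $\tau=\pm1$; the value $0$ beyond $A_i$
  -- never enters.
  set σ : ι → Fin α → ℤ := fun i r => if hr : (r : ℕ) < A i then (τ ⟨(i, r), hr⟩).sign else 0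
    with hσ
  have hσθ : ∀ θ : StepIdx α A, σ θ.1.1 θ.1.2 = (τ θ).sign := fun θ => by simp [hσ, θ.2]
  have heθ : ∀ θ : StepIdx α A, e θ = Pi.single θ.1.1 (J.step σ θ.1.1 θ.1.2) := fun θ => by
    rw [hJ, step_gridBox, hσθ]; rfl
  have hdiff : mixedDiff f y e = difference A y (J.step σ) f := by
    rw [difference_eq_mixedDiff]
    exact congrArg _ (funext heθ)
  have hyk := splittable_of_small_steps hb hα hM hx hxs (k := h) fun θ => (hh θ).le
  have hadm : J.Admissible A y σ := by
    refine ⟨mem_image_interlaceVec hb hα hyk.1 _ _ fun i r => rfl, fun i r hr => ?_, fun v hv => ?_⟩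
    · have hr' : (r : ℕ) < A i := by simpa [firstIdx] using hr
      have h0 := hτ ⟨(i, r), hr'⟩
      simp only [hσ, hr', dif_pos]
      rcases lt_or_gt_of_ne h0 with h | h
      · rw [Int.sign_eq_neg_one_of_neg h]; omega
      · rw [Int.sign_eq_one_of_pos h]; omega
    -- Each vertex of the small difference is again a point of the walk, with counters $h_\theta$ or
    -- $h_\theta+1$; as $h_\theta$ is strictly below the total, these counters are admissible.
    · have hs : shifted y (J.step σ) v =
          x + ∑ θ, (h θ + if θ.1.2 ∈ v θ.1.1 then 1 else 0) • e θ := by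
        have h1 : shifted y (J.step σ) v =
            y + ∑ θ : StepIdx α A with θ.1.2 ∈ v θ.1.1, e θ := by
          rw [Finset.sum_congr rfl fun θ _ => heθ θ,
            sum_stepIdx A v hv (fun i r => Pi.single i (J.step σ i r))]
          funext i
          simp [shifted, Finset.sum_apply, Pi.single_apply]
        rw [h1, hy, add_assoc, Finset.sum_filter, ← Finset.sum_add_distrib]
        congr 1
        refine Finset.sum_congr rfl fun θ _ => ?_
        rw [add_smul]
        split_ifs <;> simp
      have hk := splittable_of_small_steps hb hα hM hx hxs
        (k := fun θ => h θ + if θ.1.2 ∈ v θ.1.1 then 1 else 0) fun θ => by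
          have := hh θ; split_ifs <;> omega
      rw [hs]
      refine mem_image_interlaceVec hb hα hk.1 _ _ fun i r => ?_
      -- Dividing the box index by $b$ drops the last digit, leaving the $m-1$ digits that are
      -- constant along the walk.
      rw [show J.a i r = leadDigits b α (y i) r (m i r) from rfl, leadDigits_div hb _ _ _ (hm i r),
        hyk.2 i r]
      exact (hk.2 i r).symm
  have hprod : (∏ i, ∏ r ∈ firstIdx α A i, J.step σ i r) ^ 2 =
      (∏ θ : StepIdx α A, digitUnit b (θ.1.2 + (m θ.1.1 θ.1.2 - 1) * α)) ^ 2 := by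
    rw [← prod_stepIdx A, ← Finset.prod_pow, ← Finset.prod_pow]
    refine Finset.prod_congr rfl fun θ _ => ?_
    rw [hJ, step_gridBox, hσθ, mul_pow]
    rcases lt_or_gt_of_ne (hτ θ) with h | h
    · rw [Int.sign_eq_neg_one_of_neg h]; simp
    · rw [Int.sign_eq_one_of_pos h]; simp
  have hpos : 0 < (∏ θ : StepIdx α A, digitUnit b (θ.1.2 + (m θ.1.1 θ.1.2 - 1) * α)) ^ 2 :=
    pow_pos (Finset.prod_pos fun θ _ => digitUnit_pos hb _) 2
  have hsup : ENNReal.ofReal (|difference A y (J.step σ) f /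
      ∏ i, ∏ r ∈ firstIdx α A i, J.step σ i r| ^ 2) ≤ boxSup A f J :=
    le_iSup_of_le y (le_iSup₂_of_le σ hadm le_rfl)
  refine le_trans ?_ (mul_le_mul_right hsup _)
  rw [← ENNReal.ofReal_mul hpos.le, sq_abs, div_pow, hprod, mul_div_cancel₀ _ hpos.ne', hdiff]

/-- After telescoping and Cauchy–Schwarz there are $N$ translated integrals, each weighted by $ND$
and each at most $V^2$. Since $N^2D=\prod_\theta(\tau_\theta b^{-(p_\theta+1)})^2$, moving the
positions costs nothing. -/
lemma lintegral_mixedDiff_le (hb : 2 ≤ b) (hα : 1 ≤ α)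
    (hM : ∀ i, IsMatching α (A i) (p i) (m i)) {τ : StepIdx α A → ℤ} (hτ : ∀ θ, τ θ ≠ 0)
    (f : (ι → ℝ) → ℝ) :
    ∫⁻ x in changeSet b (fun θ : StepIdx α A => θ.1.1) (fun θ => p θ.1.1 θ.1.2) τ,
      ENNReal.ofReal (mixedDiff f x (digitSteps b (fun θ : StepIdx α A => θ.1.1)
        (fun θ => p θ.1.1 θ.1.2) τ) ^ 2) ≤
    ENNReal.ofReal (∏ θ : StepIdx α A, ((τ θ : ℝ) * digitUnit b (p θ.1.1 θ.1.2)) ^ 2) *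
      vitaliVariation b α A f ^ 2 := by
  set X := changeSet b (fun θ : StepIdx α A => θ.1.1) (fun θ => p θ.1.1 θ.1.2) τ with hX
  set p' : StepIdx α A → ℕ := fun θ => θ.1.2 + (m θ.1.1 θ.1.2 - 1) * α with hp'
  have hpp : ∀ θ : StepIdx α A, p θ.1.1 θ.1.2 ≤ p' θ := fun θ => (hM θ.1.1).le θ.1.2 θ.2
  set e := digitSteps b (fun θ : StepIdx α A => θ.1.1) p' (fun θ => (τ θ).sign) with he
  set n : StepIdx α A → ℕ := fun θ => (τ θ).natAbs * b ^ (p' θ - p θ.1.1 θ.1.2) with hn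
  set H := Fintype.piFinset fun θ => Finset.range (n θ) with hH
  set G : (ι → ℝ) → ENNReal := fun t =>
    boxSup A f (gridBox (fun i r => (hM i).one_le r) (gridIndex hb m t)) with hG
  have hGm : Measurable G :=
    (Measurable.of_discrete (f := fun a : ∀ i r, Fin (b ^ m i r) =>
      boxSup A f (gridBox (fun i r => (hM i).one_le r) a))).comp (measurable_gridIndex hb m)
  have hGc : ∀ c, Measurable fun x => G (x + c) := fun c => hGm.comp (measurable_add_const c)
  set N : ℝ := ∏ θ, (n θ : ℝ) with hN
  set D : ℝ := (∏ θ : StepIdx α A, digitUnit b (p' θ)) ^ 2 with hD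
  have hN0 : 0 ≤ N := Finset.prod_nonneg fun _ _ => Nat.cast_nonneg _
  have hX' : MeasurableSet X := measurableSet_changeSet b _ _ _
  have hpt : ∀ᵐ x ∂(volume.restrict X), ENNReal.ofReal (mixedDiff f x
      (digitSteps b (fun θ : StepIdx α A => θ.1.1) (fun θ => p θ.1.1 θ.1.2) τ) ^ 2) ≤
      ∑ h ∈ H, ENNReal.ofReal (N * D) * G (x + ∑ θ, h θ • e θ) := by
    rw [ae_restrict_iff' hX']
    filter_upwards [ae_mem_splittableCube hb hα] with x hxs hx
    rw [digitSteps_eq_nsmul hb hpp]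
    refine (ENNReal.ofReal_le_ofReal (mixedDiff_nsmul_sq_le f x e n)).trans ?_
    rw [ENNReal.ofReal_mul hN0, ENNReal.ofReal_sum_of_nonneg fun _ _ => sq_nonneg _,
      Finset.mul_sum]
    refine Finset.sum_le_sum fun h hh => ?_
    rw [ENNReal.ofReal_mul hN0, mul_assoc]
    refine mul_le_mul_right ?_ _
    exact mixedDiff_small_steps_le hb hα hM hτ hx (hxs (mem_unitCube.1 hx.1))
      (fun θ => Finset.mem_range.1 (Fintype.mem_piFinset.1 hh θ)) f
  refine (lintegral_mono_ae hpt).trans ?_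
  rw [lintegral_finsetSum _ fun h _ => (hGc _).const_mul _]
  have hI : ∀ h ∈ H, ∫⁻ x in X, ENNReal.ofReal (N * D) * G (x + ∑ θ, h θ • e θ) ≤
      ENNReal.ofReal (N * D) * vitaliVariation b α A f ^ 2 := by
    intro h hh
    rw [lintegral_const_mul _ (hGc _)]
    refine mul_le_mul_right (le_trans ?_ (lintegral_boxSup_le hb hα
      (fun i r => (hM i).one_le r) A f)) _
    -- The translate of the set of changeable points lies in the unit cube, so translation
    -- invariance removes the shift.
    rw [← lintegral_indicator hX', ← lintegral_indicator measurableSet_unitCube,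
      ← lintegral_add_right_eq_self ((unitCube ι).indicator _) (∑ θ, h θ • e θ)]
    refine lintegral_mono fun x => ?_
    by_cases hx : x ∈ X
    · have : x + ∑ θ, h θ • e θ ∈ unitCube ι := mem_unitCube.2 fun i => by
        have hinj : ∀ θ θ' : StepIdx α A, θ.1.1 = θ'.1.1 →
            p θ.1.1 θ.1.2 = p θ'.1.1 θ'.1.2 → θ = θ' := by
          rintro ⟨⟨i, r⟩, h⟩ ⟨⟨i', r'⟩, h'⟩ (rfl : i = i') e
          have := (hM i).injOn h h' e
          simp_all
        exact (digits_of_small_steps hb hinj hpp hx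
          (fun θ => (Finset.mem_range.1 (Fintype.mem_piFinset.1 hh θ)).le) i).1
      rw [Set.indicator_of_mem hx, Set.indicator_of_mem this]
    · rw [Set.indicator_of_notMem hx]
      exact zero_le
  refine (Finset.sum_le_sum hI).trans_eq ?_
  have hcard : (H.card : ℝ) = N := by simp [hH, hN]
  rw [Finset.sum_const, nsmul_eq_mul, ← mul_assoc]
  congr 1
  rw [← ENNReal.ofReal_natCast, hcard, ← ENNReal.ofReal_mul hN0]
  congr 1
  rw [← mul_assoc, hD, hN, ← sq, ← mul_pow, ← Finset.prod_mul_distrib, ← Finset.prod_pow]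
  refine Finset.prod_congr rfl fun θ _ => ?_
  rw [digitUnit_eq_pow_mul hb (hpp θ), ← sq_abs ((τ θ : ℝ) * _), abs_mul,
    abs_of_pos (mul_pos (pow_pos (by positivity) _) (digitUnit_pos hb _))]
  congr 1
  simp only [hn]
  push_cast
  rw [Nat.cast_natAbs]
  push_cast
  ring

end Estimate

/-! ### Changing digits and translation invariance -/

section SetDigits

/-- The points of the unit cube with a prescribed digit. -/
lemma measurableSet_digit_eq {ι : Type*} [Fintype ι] (b : ℕ) (i : ι) (n a : ℕ) :
    MeasurableSet {x ∈ unitCube ι | digit b (x i) n = a} :=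
  measurableSet_unitCube.inter
    (((measurable_digit b n).comp (measurable_pi_apply i)) (measurableSet_singleton a))

lemma integrableOn_comp_translate {ι : Type*} [Fintype ι] {g : (ι → ℝ) → ℝ} (hg : IntegrableOn g (unitCube ι))
    {S : Set (ι → ℝ)} (hS : MeasurableSet S) (c : ι → ℝ) (hc : ∀ x ∈ S, x + c ∈ unitCube ι) :
    IntegrableOn (fun x => g (x + c)) S := by
  have h1 : Integrable ((unitCube ι).indicator g) :=
    (integrable_indicator_iff measurableSet_unitCube).2 hg
  have h2 := (h1.comp_add_right c).integrableOn (s := S)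
  refine h2.congr_fun (fun x hx => ?_) hS
  exact Set.indicator_of_mem (hc x hx) g

variable {κ ι : Type*} [DecidableEq ι]

lemma sum_digitSteps_apply (b : ℕ) (j : κ → ι) (p : κ → ℕ) (τ : κ → ℤ) (v : Finset κ)
    (x : ι → ℝ) (i : ι) :
    (x + ∑ θ ∈ v, digitSteps b j p τ θ) i =
      x i + ∑ θ ∈ v with j θ = i, (τ θ : ℝ) * digitUnit b (p θ) := by
  rw [Pi.add_apply, Finset.sum_apply, Finset.sum_filter]
  congr 1
  refine Finset.sum_congr rfl fun θ _ => ?_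
  simp only [digitSteps, Pi.single_apply, eq_comm (a := i)]

lemma digits_of_changes {b : ℕ} (hb : 2 ≤ b) {j : κ → ι} {p : κ → ℕ}
    (hinj : ∀ θ θ', j θ = j θ' → p θ = p θ' → θ = θ') {τ : κ → ℤ} {x : ι → ℝ}
    (hx : x ∈ unitCube ι) (v : Finset κ)
    (h0 : ∀ θ ∈ v, 0 ≤ (digit b (x (j θ)) (p θ) : ℤ) + τ θ)
    (h1 : ∀ θ ∈ v, (digit b (x (j θ)) (p θ) : ℤ) + τ θ < b) :
    x + ∑ θ ∈ v, digitSteps b j p τ θ ∈ unitCube ι ∧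
    (∀ i n, (∀ θ ∈ v, j θ = i → p θ ≠ n) →
      digit b ((x + ∑ θ ∈ v, digitSteps b j p τ θ) i) n = digit b (x i) n) ∧
    ∀ θ ∈ v, (digit b ((x + ∑ θ ∈ v, digitSteps b j p τ θ) (j θ)) (p θ) : ℤ) =
      digit b (x (j θ)) (p θ) + τ θ := by
  have key : ∀ i, _ := fun i => digits_add_sum_units hb (mem_unitCube.1 hx i).1
    (v.filter fun θ => j θ = i) p τ
    (fun θ h θ' h' e => hinj θ θ'
      ((Finset.mem_filter.1 h).2.trans (Finset.mem_filter.1 h').2.symm) e)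
    (fun θ h => (Finset.mem_filter.1 h).2 ▸ h0 θ (Finset.mem_filter.1 h).1)
    (fun θ h => (Finset.mem_filter.1 h).2 ▸ h1 θ (Finset.mem_filter.1 h).1)
  simp only [mem_unitCube, sum_digitSteps_apply]
  refine ⟨fun i => ?_, fun i n h => ?_, fun θ h => ?_⟩
  · have := (key i).2.1 0 fun _ _ => Nat.zero_le _
    simp only [pow_zero, mul_one] at this
    rw [Int.floor_eq_zero_iff.2 (mem_unitCube.1 hx i)] at this
    exact Int.floor_eq_zero_iff.1 this
  · exact (key i).2.2.1 n fun θ hθ =>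
      (h θ (Finset.mem_filter.1 hθ).1 (Finset.mem_filter.1 hθ).2).symm
  · exact (key (j θ)).2.2.2 θ (Finset.mem_filter.2 ⟨h, rfl⟩)

/-- Changing a single digit. -/
lemma digits_of_change {b : ℕ} (hb : 2 ≤ b) {i : ι} {n : ℕ} {τ : ℤ} {x : ι → ℝ}
    (hx : x ∈ unitCube ι) (h0 : 0 ≤ (digit b (x i) n : ℤ) + τ)
    (h1 : (digit b (x i) n : ℤ) + τ < b) :
    x + Pi.single i (τ * digitUnit b n) ∈ unitCube ι ∧
    (∀ i' n', (i', n') ≠ (i, n) →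
      digit b ((x + (Pi.single i (τ * digitUnit b n) : ι → ℝ)) i') n' = digit b (x i') n') ∧
    (digit b ((x + (Pi.single i (τ * digitUnit b n) : ι → ℝ)) i) n : ℤ) = digit b (x i) n + τ := by
  have := digits_of_changes hb (κ := Unit) (j := fun _ => i) (p := fun _ => n) (τ := fun _ => τ)
    (fun _ _ _ _ => rfl) hx Finset.univ (fun _ _ => h0) (fun _ _ => h1)
  simp only [Finset.univ_unique, Finset.sum_singleton, digitSteps] at this
  refine ⟨this.1, fun i' n' h => this.2.1 i' n' fun _ _ e e' =>
    h (by rw [← e, ← e']), this.2.2 () (by simp)⟩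

variable [Fintype ι]

/-- A function that is multiplied by powers of a nontrivial root of unity when a digit is changed
has mean zero. -/
lemma integral_eq_zero_of_digit {b : ℕ} (hb : 2 ≤ b) {H : (ι → ℝ) → ℂ}
    (hH : IntegrableOn H (unitCube ι)) (i : ι) (n : ℕ) {ζ : ℂ} (hζ : ζ ^ b = 1) (hζ1 : ζ ≠ 1)
    (h : ∀ x ∈ unitCube ι, digit b (x i) n = 0 → ∀ a < b,
      H (x + Pi.single i ((a : ℤ) * digitUnit b n)) = ζ ^ a * H x) :
    ∫ x in unitCube ι, H x = 0 := by
  set C : ℕ → Set (ι → ℝ) := fun a => {x ∈ unitCube ι | digit b (x i) n = a} with hC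
  have hCm : ∀ a, MeasurableSet (C a) := fun a => measurableSet_digit_eq b i n a
  have hU : unitCube ι = ⋃ a ∈ Finset.range b, C a := by
    ext x
    simp only [hC, Set.mem_iUnion, Finset.mem_range, exists_prop, Set.mem_ofPred_eq]
    exact ⟨fun hx => ⟨_, digit_lt hb _ _, hx, rfl⟩, fun ⟨_, _, hx, _⟩ => hx⟩
  -- Adding $a$ units at position $n$ maps the points with digit $0$ bijectively onto those with
  -- digit $a$; afterwards the geometric sum of $\zeta$ vanishes.
  have hI : ∀ a < b, ∫ x in C a, H x = ζ ^ a * ∫ x in C 0, H x := by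
    intro a ha
    rw [← integral_const_mul, ← integral_indicator (hCm a), ← integral_indicator (hCm 0),
      ← integral_add_right_eq_self _ (Pi.single i (((a : ℤ) : ℝ) * digitUnit b n))]
    congr 1
    funext x
    by_cases hx : x ∈ C 0
    · have h0 : digit b (x i) n = 0 := hx.2
      have hy := digits_of_change hb (i := i) (n := n) (τ := a) hx.1 (by omega) (by omega)
      rw [Set.indicator_of_mem hx, Set.indicator_of_mem, h x hx.1 h0 a ha]
      refine ⟨hy.1, ?_⟩
      have := hy.2.2
      rw [h0] at this
      exact_mod_cast this.trans (zero_add _)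
    · rw [Set.indicator_of_notMem hx, Set.indicator_of_notMem]
      rintro ⟨hy1, hy2⟩
      have hy := digits_of_change hb (i := i) (n := n) (τ := -a) hy1 (by omega) (by omega)
      rw [add_assoc, ← Pi.single_add] at hy
      push_cast at hy hy2
      rw [neg_mul, add_neg_cancel, Pi.single_zero, add_zero] at hy
      refine hx ⟨hy.1, ?_⟩
      have := hy.2.2
      rw [hy2] at this
      exact_mod_cast this.trans (add_neg_cancel _)
  rw [hU, integral_biUnion_finset _ (fun a _ => hCm a) ?_ ?_,
    Finset.sum_congr rfl fun a ha => hI a (Finset.mem_range.1 ha), ← Finset.sum_mul]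
  · have : ∑ a ∈ Finset.range b, ζ ^ a = 0 := by
      have h1 := mul_neg_geom_sum ζ b
      rw [hζ, sub_self] at h1
      exact (mul_eq_zero.1 h1).resolve_left (sub_ne_zero.2 hζ1.symm)
    rw [this, zero_mul]
  · intro a _ a' _ hne
    rw [Function.onFun, Set.disjoint_left]
    exact fun x hx hx' => hne (hx.2.symm.trans hx'.2)
  · exact fun a _ => hH.mono_set fun x hx => hx.1

end SetDigits

/-! ### Walsh functions -/

/-- The primitive `b`th root of unity `e^{2πi/b}`. -/
noncomputable def rootOfUnity (b : ℕ) : ℂ := Complex.exp (2 * Real.pi * Complex.I / b)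

lemma isPrimitiveRoot_rootOfUnity {b : ℕ} (hb : 2 ≤ b) : IsPrimitiveRoot (rootOfUnity b) b :=
  Complex.isPrimitiveRoot_exp b (by omega)

lemma norm_rootOfUnity {b : ℕ} (hb : 2 ≤ b) : ‖rootOfUnity b‖ = 1 :=
  (isPrimitiveRoot_rootOfUnity hb).norm'_eq_one (by omega)

lemma natDigit_eq_zero {b : ℕ} (hb : 2 ≤ b) {k n : ℕ} (h : k ≤ n) : natDigit b k n = 0 := by
  have : k < b ^ n := h.trans_lt (Nat.lt_pow_self (by omega))
  rw [natDigit, Nat.div_eq_of_lt this, Nat.zero_mod]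

lemma natDigit_lt {b : ℕ} (hb : 2 ≤ b) (k n : ℕ) : natDigit b k n < b := Nat.mod_lt _ (by omega)

lemma eq_of_natDigit_eq {b : ℕ} (hb : 2 ≤ b) : ∀ {k k' : ℕ},
    (∀ n, natDigit b k n = natDigit b k' n) → k = k' := by
  intro k
  induction k using Nat.strong_induction_on with
  | _ k ih =>
    intro k' h
    have h0 : k % b = k' % b := by simpa [natDigit] using h 0
    have hs : ∀ n, natDigit b (k / b) n = natDigit b (k' / b) n := fun n => by
      have := h (n + 1)
      simpa only [natDigit, pow_succ', ← Nat.div_div_eq_div_mul] using this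
    rcases Nat.eq_zero_or_pos k with rfl | hk
    · have : ∀ n, natDigit b k' n = 0 := fun n => (h n).symm.trans (natDigit_eq_zero hb (Nat.zero_le n))
      by_contra hne
      have hk' : 0 < k' := Nat.pos_of_ne_zero (Ne.symm hne)
      have hlog := this (Nat.log b k')
      have h1 : k' / b ^ Nat.log b k' < b := by
        rw [Nat.div_lt_iff_lt_mul (by positivity), ← pow_succ']
        exact Nat.lt_pow_succ_log_self (by omega) k'
      rw [natDigit, Nat.mod_eq_of_lt h1] at hlog
      have h2 := Nat.div_pos (Nat.pow_log_le_self b hk'.ne') (by positivity)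
      omega
    · have := ih (k / b) (Nat.div_lt_self hk (by omega)) hs
      rw [← Nat.div_add_mod k b, ← Nat.div_add_mod k' b, this, h0]

lemma walsh_eq_pow {b : ℕ} (hb : 2 ≤ b) (k : ℕ) (x : ℝ) {M : ℕ} (hM : k ≤ M) :
    walsh b k x = rootOfUnity b ^ ∑ a ∈ Finset.range M, natDigit b k a * digit b x a := by
  rw [walsh, rootOfUnity]
  congr 1
  refine Finset.sum_subset (Finset.range_mono hM) fun a _ ha => ?_
  rw [natDigit_eq_zero hb (by simpa using ha), zero_mul]

lemma walsh_change {b : ℕ} (hb : 2 ≤ b) (k : ℕ) {x y : ℝ} {n : ℕ}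
    (h : ∀ a, a ≠ n → digit b y a = digit b x a) (h0 : digit b x n = 0) :
    walsh b k y = (rootOfUnity b ^ natDigit b k n) ^ digit b y n * walsh b k x := by
  rw [walsh_eq_pow hb k x (le_max_left k (n + 1)), walsh_eq_pow hb k y (le_max_left k (n + 1)),
    ← pow_mul, ← pow_add]
  congr 1
  have hn : n ∈ Finset.range (max k (n + 1)) := by simp
  rw [← Finset.add_sum_erase _ _ hn, ← Finset.add_sum_erase _ (fun a => natDigit b k a * _) hn, h0]
  rw [mul_zero, zero_add]
  congr 1
  exact Finset.sum_congr rfl fun a ha => by rw [h a (Finset.ne_of_mem_erase ha)]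

lemma norm_walsh {b : ℕ} (hb : 2 ≤ b) (k : ℕ) (x : ℝ) : ‖walsh b k x‖ = 1 := by
  rw [walsh_eq_pow hb k x le_rfl, norm_pow, norm_rootOfUnity hb, one_pow]

lemma measurable_walsh (b k : ℕ) : Measurable (walsh b k) := by
  unfold walsh
  refine (measurable_from_nat (f := fun n : ℕ =>
    Complex.exp (2 * Real.pi * Complex.I / b) ^ n)).comp ?_
  exact Finset.measurable_sum _ fun a _ => (measurable_digit b a).const_mul _

section ProdWalsh

variable {ι : Type*} [Fintype ι]

/-- The Walsh function `wal_K` on the unit cube. -/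
noncomputable def prodWalsh (b : ℕ) (K : ι → ℕ) (x : ι → ℝ) : ℂ := ∏ i, walsh b (K i) (x i)

lemma norm_prodWalsh {b : ℕ} (hb : 2 ≤ b) (K : ι → ℕ) (x : ι → ℝ) : ‖prodWalsh b K x‖ = 1 := by
  rw [prodWalsh, norm_prod]
  exact Finset.prod_eq_one fun i _ => norm_walsh hb _ _

lemma measurable_prodWalsh (b : ℕ) (K : ι → ℕ) : Measurable (prodWalsh b K) :=
  Finset.measurable_prod _ fun i _ => (measurable_walsh b (K i)).comp (measurable_pi_apply i)

lemma prodWalsh_change [DecidableEq ι] {b : ℕ} (hb : 2 ≤ b) (K : ι → ℕ) {x : ι → ℝ}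
    (hx : x ∈ unitCube ι) {i : ι} {n : ℕ} (h0 : digit b (x i) n = 0) {a : ℕ} (ha : a < b) :
    prodWalsh b K (x + Pi.single i ((a : ℤ) * digitUnit b n)) =
      (rootOfUnity b ^ natDigit b (K i) n) ^ a * prodWalsh b K x := by
  obtain ⟨-, h1, h2⟩ := digits_of_change hb (i := i) (n := n) (τ := a) hx (by omega) (by omega)
  have h2 : digit b ((x + (Pi.single i (((a : ℤ) : ℝ) * digitUnit b n) : ι → ℝ)) i) n = a := by
    rw [h0] at h2
    exact_mod_cast h2.trans (zero_add _)
  unfold prodWalsh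
  rw [← Finset.mul_prod_erase _ _ (Finset.mem_univ i),
    ← Finset.mul_prod_erase _ (fun i => walsh b (K i) (x i)) (Finset.mem_univ i), ← mul_assoc,
    walsh_change hb (K i) (fun a' ha' => h1 i a' (by simp [ha'])) h0, h2]
  congr 1
  refine Finset.prod_congr rfl fun i' hi' => ?_
  have := Finset.ne_of_mem_erase hi'
  simp [this]

lemma volume_unitCube : volume (unitCube ι) = 1 := by
  rw [unitCube, Real.volume_pi_Ico]
  simp

lemma integrableOn_mul_prodWalsh {b : ℕ} (hb : 2 ≤ b) {g : (ι → ℝ) → ℂ}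
    (hg : IntegrableOn g (unitCube ι)) (K : ι → ℕ) :
    IntegrableOn (fun x => g x * (starRingEnd ℂ) (prodWalsh b K x)) (unitCube ι) := by
  refine Integrable.mul_bdd (c := 1) hg ?_ ?_
  · exact (Complex.continuous_conj.measurable.comp (measurable_prodWalsh b K)).aestronglyMeasurable
  · refine Filter.Eventually.of_forall fun x => ?_
    rw [RCLike.norm_conj, norm_prodWalsh hb]

lemma integrableOn_prodWalsh {b : ℕ} (hb : 2 ≤ b) (K : ι → ℕ) :
    IntegrableOn (prodWalsh b K) (unitCube ι) := by
  refine Measure.integrableOn_of_bounded (M := 1) (by simp [volume_unitCube])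
    (measurable_prodWalsh b K).aestronglyMeasurable ?_
  exact Filter.Eventually.of_forall fun x => (norm_prodWalsh hb K x).le

/-- The mean of a digit-invariant function against a Walsh function vanishes. -/
lemma integral_mul_prodWalsh_eq_zero [DecidableEq ι] {b : ℕ} (hb : 2 ≤ b) {g : (ι → ℝ) → ℂ}
    (hg : IntegrableOn g (unitCube ι)) (K : ι → ℕ) {i : ι} {n κ : ℕ} (hκ : κ < b)
    (hne : natDigit b (K i) n ≠ κ)
    (h : ∀ x ∈ unitCube ι, digit b (x i) n = 0 → ∀ a < b,
      g (x + Pi.single i ((a : ℤ) * digitUnit b n)) = (rootOfUnity b ^ κ) ^ a * g x) :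
    ∫ x in unitCube ι, g x * (starRingEnd ℂ) (prodWalsh b K x) = 0 := by
  have hprim := isPrimitiveRoot_rootOfUnity hb
  have hconj : (starRingEnd ℂ) (rootOfUnity b) = (rootOfUnity b)⁻¹ := by
    rw [Complex.inv_def, Complex.normSq_eq_norm_sq, norm_rootOfUnity hb]
    simp
  -- The product changes by the powers of $\omega^{\kappa-\kappa'}$, where $\kappa'$ is the digit of
  -- $K_i$. This is not $1$, as $\kappa\ne\kappa'$ are both below $b$. The case $\kappa=0$ covers
  -- functions independent of the digit, other $\kappa$ the orthogonality of Walsh functions.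
  refine integral_eq_zero_of_digit hb (integrableOn_mul_prodWalsh hb hg K) i n
    (ζ := rootOfUnity b ^ κ * (starRingEnd ℂ) (rootOfUnity b ^ natDigit b (K i) n)) ?_ ?_ ?_
  · rw [mul_pow, ← map_pow, ← pow_mul, ← pow_mul, mul_comm κ, mul_comm (natDigit _ _ _), pow_mul,
      pow_mul, hprim.pow_eq_one]
    simp
  · intro e
    rw [map_pow, hconj, inv_pow, mul_inv_eq_one₀ (pow_ne_zero _ (hprim.ne_zero (by omega)))] at e
    exact hne (hprim.pow_inj hκ (natDigit_lt hb _ _) e).symm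
  · intro x hx h0 a ha
    rw [h x hx h0 a ha, prodWalsh_change hb K hx h0 ha, map_mul, mul_pow, map_pow]
    ring

lemma integral_prodWalsh_mul {b : ℕ} (hb : 2 ≤ b) (K K' : ι → ℕ) :
    ∫ x in unitCube ι, prodWalsh b K x * (starRingEnd ℂ) (prodWalsh b K' x) =
      if K = K' then 1 else 0 := by
  classical
  split_ifs with h
  · subst h
    have : ∀ x, prodWalsh b K x * (starRingEnd ℂ) (prodWalsh b K x) = 1 := fun x => by
      rw [Complex.mul_conj, Complex.normSq_eq_norm_sq, norm_prodWalsh hb]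
      simp
    simp [this, volume_unitCube, Measure.real]
  · obtain ⟨i, hi⟩ := Function.ne_iff.1 h
    have : ∃ n, natDigit b (K i) n ≠ natDigit b (K' i) n := by
      by_contra hc
      push Not at hc
      exact hi (eq_of_natDigit_eq hb hc)
    obtain ⟨n, hn⟩ := this
    exact integral_mul_prodWalsh_eq_zero hb (integrableOn_prodWalsh hb K) K'
      (natDigit_lt hb (K i) n) hn.symm fun x hx h0 a ha => prodWalsh_change hb K hx h0 ha

/-- Bessel's inequality for Walsh functions. -/
lemma bessel_prodWalsh {b : ℕ} (hb : 2 ≤ b) {h : (ι → ℝ) → ℝ}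
    (hh : IntegrableOn h (unitCube ι)) (𝒦 : Finset (ι → ℕ)) :
    ENNReal.ofReal (∑ K ∈ 𝒦,
      ‖∫ x in unitCube ι, (h x : ℂ) * (starRingEnd ℂ) (prodWalsh b K x)‖ ^ 2) ≤
    ∫⁻ x in unitCube ι, ENNReal.ofReal (h x ^ 2) := by
  set c : (ι → ℕ) → ℂ := fun K =>
    ∫ x in unitCube ι, (h x : ℂ) * (starRingEnd ℂ) (prodWalsh b K x) with hc
  set S : ℝ := ∑ K ∈ 𝒦, ‖c K‖ ^ 2 with hS
  have hS0 : 0 ≤ S := Finset.sum_nonneg fun _ _ => sq_nonneg _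
  have hhc : IntegrableOn (fun x => (h x : ℂ)) (unitCube ι) := hh.ofReal
  -- Square integrability of $h$ is not assumed. With the Walsh polynomial $W$ of the coefficients,
  -- $S=\int h\overline W=\int|W|^2$, and Hölder in $[0,\infty]$ gives $S\le\|h\|_2S^{1/2}$, from
  -- which $S^{1/2}$ is cancelled.
  set W : (ι → ℝ) → ℂ := fun x => ∑ K ∈ 𝒦, c K * prodWalsh b K x with hW
  have hWm : Measurable W :=
    Finset.measurable_sum _ fun K _ => (measurable_prodWalsh b K).const_mul _
  have hWi : IntegrableOn W (unitCube ι) :=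
    integrable_finsetSum _ fun K _ => (integrableOn_prodWalsh hb K).const_mul _
  have expand : ∀ φ : (ι → ℝ) → ℂ, IntegrableOn φ (unitCube ι) →
      ∫ x in unitCube ι, φ x * (starRingEnd ℂ) (W x) = ∑ K ∈ 𝒦, (starRingEnd ℂ) (c K) *
        ∫ x in unitCube ι, φ x * (starRingEnd ℂ) (prodWalsh b K x) := by
    intro φ hφ
    simp_rw [← integral_const_mul]
    rw [← integral_finsetSum _ fun K _ => (integrableOn_mul_prodWalsh hb hφ K).const_mul _]
    congr 1
    funext x
    rw [hW, map_sum, Finset.mul_sum]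
    refine Finset.sum_congr rfl fun K _ => ?_
    rw [map_mul]
    ring
  have h1 : ∫ x in unitCube ι, (h x : ℂ) * (starRingEnd ℂ) (W x) = (S : ℂ) := by
    rw [expand _ hhc, hS]
    push_cast
    exact Finset.sum_congr rfl fun K _ => Complex.conj_mul' _
  have h2 : ∫ x in unitCube ι, W x * (starRingEnd ℂ) (W x) = (S : ℂ) := by
    rw [expand _ hWi, hS]
    push_cast
    refine Finset.sum_congr rfl fun K hK => ?_
    have : ∫ x in unitCube ι, W x * (starRingEnd ℂ) (prodWalsh b K x) = c K := by
      simp_rw [hW, Finset.sum_mul, mul_assoc]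
      rw [integral_finsetSum _ fun K' _ =>
        (integrableOn_mul_prodWalsh hb (integrableOn_prodWalsh hb K') K).const_mul _]
      simp_rw [integral_const_mul, integral_prodWalsh_mul hb]
      simp [hK]
    rw [this]
    exact Complex.conj_mul' _
  have h3 : ∫⁻ x in unitCube ι, ‖W x‖ₑ ^ (2 : ℝ) = ENNReal.ofReal S := by
    have h4 : ∀ x, W x * (starRingEnd ℂ) (W x) = ((‖W x‖ ^ 2 : ℝ) : ℂ) := fun x => by
      rw [Complex.mul_conj']; push_cast; rfl
    simp_rw [h4] at h2
    rw [integral_complex_ofReal] at h2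
    have h2 : ∫ x in unitCube ι, ‖W x‖ ^ 2 = S := by exact_mod_cast h2
    rw [← h2, ofReal_integral_eq_lintegral_ofReal]
    · refine lintegral_congr fun x => ?_
      rw [← ofReal_norm, ENNReal.ofReal_rpow_of_nonneg (norm_nonneg _) (by norm_num)]
      norm_num
    · have hi : IntegrableOn (fun x => W x * (starRingEnd ℂ) (W x)) (unitCube ι) := by
        simp_rw [hW, map_sum, Finset.mul_sum, map_mul]
        refine integrable_finsetSum _ fun K _ => ?_
        have := (integrableOn_mul_prodWalsh hb hWi K).const_mul ((starRingEnd ℂ) (c K))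
        refine this.congr (Filter.Eventually.of_forall fun x => ?_)
        simp only [hW]
        ring
      simp_rw [h4] at hi
      exact (hi.re).congr (Filter.Eventually.of_forall fun x => by simp [-Complex.ofReal_pow])
    · exact Filter.Eventually.of_forall fun x => sq_nonneg _
  have h5 : ENNReal.ofReal S ≤ (∫⁻ x in unitCube ι, ENNReal.ofReal (h x ^ 2)) ^ (1 / 2 : ℝ) *
      ENNReal.ofReal S ^ (1 / 2 : ℝ) := by
    have e1 : ENNReal.ofReal S = ‖∫ x in unitCube ι, (h x : ℂ) * (starRingEnd ℂ) (W x)‖ₑ := by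
      rw [h1, ← ofReal_norm, Complex.norm_real, Real.norm_of_nonneg hS0]
    have e2 : ENNReal.ofReal S ^ (1 / 2 : ℝ) =
        (∫⁻ x in unitCube ι, ‖W x‖ₑ ^ (2 : ℝ)) ^ (1 / 2 : ℝ) := by rw [h3]
    rw [e2]
    calc ENNReal.ofReal S ≤ ∫⁻ x in unitCube ι, ((fun x => ‖h x‖ₑ) * fun x => ‖W x‖ₑ) x := by
          rw [e1]
          refine (enorm_integral_le_lintegral_enorm _).trans_eq (lintegral_congr fun x => ?_)
          rw [enorm_mul, RCLike.enorm_conj, Pi.mul_apply]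
          congr 1
          rw [← ofReal_norm, Complex.norm_real, ofReal_norm]
      _ ≤ (∫⁻ x in unitCube ι, ‖h x‖ₑ ^ (2 : ℝ)) ^ (1 / 2 : ℝ) *
          (∫⁻ x in unitCube ι, ‖W x‖ₑ ^ (2 : ℝ)) ^ (1 / 2 : ℝ) :=
        ENNReal.lintegral_mul_le_Lp_mul_Lq _ Real.HolderConjugate.two_two
          hh.aestronglyMeasurable.enorm hWm.enorm.aemeasurable
      _ = _ := by
        congr 2
        refine lintegral_congr fun x => ?_
        rw [← ofReal_norm, ENNReal.ofReal_rpow_of_nonneg (norm_nonneg _) (by norm_num)]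
        norm_num
  rcases eq_or_ne (ENNReal.ofReal S) 0 with h0 | h0
  · rw [h0]; exact zero_le
  set N := ∫⁻ x in unitCube ι, ENNReal.ofReal (h x ^ 2)
  have hs : ENNReal.ofReal S = ENNReal.ofReal S ^ (1 / 2 : ℝ) * ENNReal.ofReal S ^ (1 / 2 : ℝ) := by
    rw [← ENNReal.rpow_add_of_nonneg _ _ (by norm_num) (by norm_num)]
    norm_num
  have h6 : ENNReal.ofReal S ^ (1 / 2 : ℝ) ≤ N ^ (1 / 2 : ℝ) := by
    nth_rw 1 [hs] at h5
    refine (ENNReal.mul_le_mul_iff_left ?_ ?_).1 h5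
    · simp [ENNReal.rpow_eq_zero_iff, h0]
    · simp
  exact (ENNReal.rpow_le_rpow_iff (by norm_num)).1 h6

end ProdWalsh

/-! ### Averaging over digits -/

section Averaging

variable {κ ι : Type*}

/-- The changes of digits that turn the digits of `x` into `c`. -/
noncomputable def digitDiff (b : ℕ) (j : κ → ι) (p : κ → ℕ) {b' : ℕ} (c : κ → Fin b') (x : ι → ℝ)
    (θ : κ) : ℤ :=
  (c θ : ℤ) - digit b (x (j θ)) (p θ)

/-- The points of the unit cube with prescribed digits `w`. -/
def digitPiece (b : ℕ) (j : κ → ι) (p : κ → ℕ) {b' : ℕ} (w : κ → Fin b') : Set (ι → ℝ) :=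
  {x ∈ unitCube ι | ∀ θ, digit b (x (j θ)) (p θ) = w θ}

lemma measurableSet_digitPiece [Fintype ι] [Finite κ] (b : ℕ) (j : κ → ι) (p : κ → ℕ) {b' : ℕ}
    (w : κ → Fin b') : MeasurableSet (digitPiece b j p w) := by
  have : digitPiece b j p w =
      unitCube ι ∩ ⋂ θ, (fun x : ι → ℝ => digit b (x (j θ)) (p θ)) ⁻¹' {(w θ : ℕ)} := by
    ext
    simp [digitPiece]
  rw [this]
  exact measurableSet_unitCube.inter (MeasurableSet.iInter fun θ =>
    ((measurable_digit b (p θ)).comp (measurable_pi_apply (j θ))) (measurableSet_singleton _))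

lemma unitCube_eq_iUnion_digitPiece {b : ℕ} (hb : 2 ≤ b) (j : κ → ι) (p : κ → ℕ) :
    unitCube ι = ⋃ w : κ → Fin b, digitPiece b j p w := by
  ext x
  simp only [Set.mem_iUnion]
  exact ⟨fun hx => ⟨fun θ => ⟨_, digit_lt hb _ _⟩, hx, fun θ => rfl⟩, fun ⟨_, hx⟩ => hx.1⟩

lemma digitPiece_disjoint (b : ℕ) (j : κ → ι) (p : κ → ℕ) {b' : ℕ} {w w' : κ → Fin b'}
    (h : w ≠ w') : Disjoint (digitPiece b j p w) (digitPiece b j p w') := by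
  rw [Set.disjoint_left]
  refine fun x hx hx' => h (funext fun θ => Fin.ext ?_)
  rw [← hx.2 θ, hx'.2 θ]

lemma digitDiff_eq_of_mem {b : ℕ} {j : κ → ι} {p : κ → ℕ} {c w : κ → Fin b} {x : ι → ℝ}
    (hx : x ∈ digitPiece b j p w) : digitDiff b j p c x = fun θ => (c θ : ℤ) - w θ := by
  funext θ
  rw [digitDiff, hx.2 θ]

variable [DecidableEq ι]

/-- The digit at $\theta_0\in v$ is overwritten by $c_{\theta_0}$, so its previous value is
forgotten. -/
lemma changed_point_invariant [DecidableEq κ] {b : ℕ} (hb : 2 ≤ b) {j : κ → ι} {p : κ → ℕ}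
    (hinj : ∀ θ θ', j θ = j θ' → p θ = p θ' → θ = θ') (c : κ → Fin b) {x : ι → ℝ}
    (hx : x ∈ unitCube ι) {v : Finset κ} {θ₀ : κ} (hθ : θ₀ ∈ v)
    (h0 : digit b (x (j θ₀)) (p θ₀) = 0) {a : ℕ} (ha : a < b) :
    (x + Pi.single (j θ₀) ((a : ℤ) * digitUnit b (p θ₀))) + ∑ θ ∈ v, digitSteps b j p
      (digitDiff b j p c (x + Pi.single (j θ₀) ((a : ℤ) * digitUnit b (p θ₀)))) θ =
    x + ∑ θ ∈ v, digitSteps b j p (digitDiff b j p c x) θ := by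
  obtain ⟨-, h1, h2⟩ := digits_of_change hb (i := j θ₀) (n := p θ₀) (τ := a) hx (by omega)
    (by omega)
  rw [← Finset.add_sum_erase _ _ hθ, ← Finset.add_sum_erase _ (digitSteps b j p _) hθ,
    ← add_assoc, ← add_assoc]
  congr 1
  · rw [add_assoc]
    congr 1
    rw [digitSteps, digitSteps, ← Pi.single_add]
    congr 1
    rw [digitDiff, digitDiff, h2, h0]
    push_cast
    ring
  · refine Finset.sum_congr rfl fun θ h => ?_
    have hne := Finset.ne_of_mem_erase h
    rw [digitSteps, digitSteps]
    congr 2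
    rw [digitDiff, digitDiff, h1]
    rintro e
    exact hne (hinj _ _ (congrArg Prod.fst e) (congrArg Prod.snd e))

/-- A zero step makes the factor $1-X^0$ of the product vanish. -/
lemma mixedDiff_digitSteps_eq_zero [Fintype κ] {b : ℕ} (j : κ → ι) (p : κ → ℕ) (g : (ι → ℝ) → ℝ) (x : ι → ℝ)
    {τ : κ → ℤ} {θ : κ} (h : τ θ = 0) : mixedDiff g x (digitSteps b j p τ) = 0 := by
  rw [mixedDiff_eq, Finset.prod_eq_zero (Finset.mem_univ θ), mul_zero, map_zero]
  simp [digitSteps, h, AddMonoidAlgebra.one_def]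

variable [Fintype ι] [Fintype κ]

/-- Overwriting digits is a translation on each of the finitely many pieces with prescribed digits.
-/
lemma integrableOn_changed_point {b : ℕ} (hb : 2 ≤ b) {j : κ → ι} {p : κ → ℕ}
    (hinj : ∀ θ θ', j θ = j θ' → p θ = p θ' → θ = θ') {g : (ι → ℝ) → ℝ}
    (hg : IntegrableOn g (unitCube ι)) (c : κ → Fin b) (v : Finset κ) :
    IntegrableOn (fun x => g (x + ∑ θ ∈ v, digitSteps b j p (digitDiff b j p c x) θ))
      (unitCube ι) := by
  rw [unitCube_eq_iUnion_digitPiece hb j p, integrableOn_finite_iUnion]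
  intro w
  have hm := measurableSet_digitPiece b j p w
  refine (integrableOn_comp_translate hg hm
    (∑ θ ∈ v, digitSteps b j p (fun θ => (c θ : ℤ) - w θ) θ) fun x hx => ?_).congr_fun
    (fun x hx => ?_) hm
  · refine (digits_of_changes hb hinj hx.1 v (fun θ _ => ?_) fun θ _ => ?_).1
    · rw [hx.2 θ]; omega
    · rw [hx.2 θ]; omega
  · simp only
    rw [digitDiff_eq_of_mem hx]

/-- Walsh coefficients of `g` as coefficients of mixed differences of `g`. -/
lemma integral_mixedDiff_mul_prodWalsh {b : ℕ} (hb : 2 ≤ b) {j : κ → ι} {p : κ → ℕ}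
    (hinj : ∀ θ θ', j θ = j θ' → p θ = p θ' → θ = θ') {g : (ι → ℝ) → ℝ}
    (hg : IntegrableOn g (unitCube ι)) (c : κ → Fin b) {K : ι → ℕ}
    (hK : ∀ θ, natDigit b (K (j θ)) (p θ) ≠ 0) :
    ∫ x in unitCube ι, ((mixedDiff g x (digitSteps b j p (digitDiff b j p c x)) : ℝ) : ℂ) *
      (starRingEnd ℂ) (prodWalsh b K x) =
    ∫ x in unitCube ι, (g x : ℂ) * (starRingEnd ℂ) (prodWalsh b K x) := by
  classical
  have hi : ∀ v : Finset κ, IntegrableOn (fun x =>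
      ((g (x + ∑ θ ∈ v, digitSteps b j p (digitDiff b j p c x) θ) : ℝ) : ℂ)) (unitCube ι) :=
    fun v => (integrableOn_changed_point hb hinj hg c v).ofReal
  simp only [mixedDiff, Complex.ofReal_sum, Complex.ofReal_mul, Finset.sum_mul, mul_assoc]
  rw [integral_finsetSum _ fun v _ => (integrableOn_mul_prodWalsh hb (hi v) K).const_mul _]
  simp only [integral_const_mul]
  -- For nonempty $v$ the term does not depend on some digit at which $K$ is nonzero, so it
  -- integrates to $0$.
  rw [Finset.sum_eq_single ∅]
  · simp
  · intro v _ hv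
    obtain ⟨θ₀, hθ⟩ := Finset.nonempty_iff_ne_empty.2 hv
    rw [integral_mul_prodWalsh_eq_zero hb (hi v) K (i := j θ₀) (n := p θ₀) (κ := 0) (by omega)
      (hK θ₀), mul_zero]
    intro x hx h0 a ha
    rw [changed_point_invariant hb hinj c hx hθ h0 ha]
    simp
  · simp

/-- On the piece with digits $w$ the change is $\tau=c-w$. For fixed $\tau$ the digits $w$ determine
$c$, so the pieces that occur are disjoint subsets of `changeSet b j p τ`. Changes with a zero
component contribute nothing. -/
lemma sum_lintegral_mixedDiff_le [DecidableEq κ] {b : ℕ} (hb : 2 ≤ b) (j : κ → ι) (p : κ → ℕ)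
    (g : (ι → ℝ) → ℝ) :
    ∑ c : κ → Fin b, ∫⁻ x in unitCube ι,
      ENNReal.ofReal (mixedDiff g x (digitSteps b j p (digitDiff b j p c x)) ^ 2) ≤
    ∑ τ ∈ Fintype.piFinset fun _ : κ => (Finset.Icc (1 - (b : ℤ)) (b - 1)).erase 0,
      ∫⁻ x in changeSet b j p τ, ENNReal.ofReal (mixedDiff g x (digitSteps b j p τ) ^ 2) := by
  set T := Fintype.piFinset fun _ : κ => (Finset.Icc (1 - (b : ℤ)) (b - 1)).erase 0 with hT
  set φ : (κ → ℤ) → (ι → ℝ) → ENNReal := fun τ x =>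
    ENNReal.ofReal (mixedDiff g x (digitSteps b j p τ) ^ 2) with hφ
  set δ : (κ → Fin b) × (κ → Fin b) → κ → ℤ := fun q θ => (q.1 θ : ℤ) - q.2 θ with hδ
  have h1 : ∀ c : κ → Fin b, ∫⁻ x in unitCube ι,
      ENNReal.ofReal (mixedDiff g x (digitSteps b j p (digitDiff b j p c x)) ^ 2) ≤
      ∑ w : κ → Fin b, ∫⁻ x in digitPiece b j p w, φ (δ (c, w)) x := by
    intro c
    rw [unitCube_eq_iUnion_digitPiece hb j p]
    refine (lintegral_iUnion_le _ _).trans ?_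
    rw [tsum_fintype]
    refine Finset.sum_le_sum fun w _ => le_of_eq ?_
    refine setLIntegral_congr_fun (measurableSet_digitPiece b j p w) fun x hx => ?_
    simp only [hφ, hδ, digitDiff_eq_of_mem hx]
  refine (Finset.sum_le_sum fun c _ => h1 c).trans ?_
  rw [← Fintype.sum_prod_type' (f := fun c w => ∫⁻ x in digitPiece b j p w, φ (δ (c, w)) x)]
  have hzero : ∀ q ∈ Finset.univ, q ∉ Finset.univ.filter (fun q => δ q ∈ T) →
      ∫⁻ x in digitPiece b j p q.2, φ (δ (q.1, q.2)) x = 0 := by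
    intro q _ hq
    have : ∃ θ, δ q θ = 0 := by
      by_contra hc
      push Not at hc
      refine hq (Finset.mem_filter.2 ⟨Finset.mem_univ _, Fintype.mem_piFinset.2 fun θ =>
        Finset.mem_erase.2 ⟨hc θ, Finset.mem_Icc.2 ?_⟩⟩)
      simp only [hδ]
      omega
    obtain ⟨θ, hθ⟩ := this
    simp only [hφ]
    simp [mixedDiff_digitSteps_eq_zero j p g _ hθ]
  rw [← Finset.sum_subset (Finset.filter_subset _ _) hzero,
    ← Finset.sum_fiberwise_of_maps_to (g := δ) (t := T) fun q hq => (Finset.mem_filter.1 hq).2]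
  refine Finset.sum_le_sum fun τ _ => ?_
  have h2 : ∑ q ∈ (Finset.univ.filter fun q => δ q ∈ T).filter (fun q => δ q = τ),
      ∫⁻ x in digitPiece b j p q.2, φ (δ (q.1, q.2)) x =
      ∫⁻ x in ⋃ q ∈ (Finset.univ.filter fun q => δ q ∈ T).filter (fun q => δ q = τ),
        digitPiece b j p q.2, φ τ x := by
    rw [lintegral_biUnion_finset]
    · exact Finset.sum_congr rfl fun q hq => by rw [show δ (q.1, q.2) = τ from (Finset.mem_filter.1 hq).2]
    · intro q hq q' hq' hne
      refine digitPiece_disjoint b j p fun e => hne (Prod.ext (funext fun θ => Fin.ext ?_) e)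
      have e1 : δ q = τ := (Finset.mem_filter.1 (Finset.mem_coe.1 hq)).2
      have e2 : δ q' = τ := (Finset.mem_filter.1 (Finset.mem_coe.1 hq')).2
      have := congrFun (e1.trans e2.symm) θ
      simp only [hδ, e] at this
      omega
    · exact fun q _ => measurableSet_digitPiece b j p q.2
  rw [h2]
  refine lintegral_mono_set (Set.iUnion₂_subset fun q hq x hx => ⟨hx.1, fun θ => ?_⟩)
  have e1 : δ q = τ := (Finset.mem_filter.1 hq).2
  rw [hx.2 θ, ← e1]
  simp only [hδ]
  omega

end Averaging

/-- The sum equals $(b-1)b(2b-1)/3$, which falls short of the bound by $b(b-1)(b-2)/3$. The factor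
$b$ on the right is the one removed by averaging over $c$. -/
lemma sum_sq_digit_changes_le {b : ℕ} (hb : 2 ≤ b) :
    ∑ τ ∈ (Finset.Icc (1 - (b : ℤ)) (b - 1)).erase 0, (τ : ℝ) ^ 2 ≤ b * ((b : ℝ) - 1) ^ 2 := by
  have hsub : (Finset.Icc (1 - (b : ℤ)) (b - 1)).erase 0 ⊆
      (Finset.range b).image (fun k : ℕ => (k : ℤ)) ∪
        (Finset.range b).image (fun k : ℕ => -(k : ℤ)) := by
    intro τ hτ
    obtain ⟨-, hτ⟩ := Finset.mem_erase.1 hτ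
    obtain ⟨h1, h2⟩ := Finset.mem_Icc.1 hτ
    rcases le_total 0 τ with h | h
    · exact Finset.mem_union_left _ (Finset.mem_image.2 ⟨τ.toNat, by simp; omega, by simp [h]⟩)
    · exact Finset.mem_union_right _ (Finset.mem_image.2
        ⟨(-τ).toNat, by simp; omega, by simp [h]⟩)
  have hcube : ∀ n : ℕ, 6 * ∑ k ∈ Finset.range n, (k : ℝ) ^ 2 = (n - 1) * n * (2 * n - 1) := by
    intro n
    induction n with
    | zero => simp
    | succ n ih => rw [Finset.sum_range_succ, mul_add, ih]; push_cast; ring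
  have h1 : ∑ τ ∈ (Finset.range b).image (fun k : ℕ => (k : ℤ)), (τ : ℝ) ^ 2 =
      ∑ k ∈ Finset.range b, (k : ℝ) ^ 2 := by
    rw [Finset.sum_image (by intro _ _ _ _ h; simpa using h)]
    simp
  have h2 : ∑ τ ∈ (Finset.range b).image (fun k : ℕ => -(k : ℤ)), (τ : ℝ) ^ 2 =
      ∑ k ∈ Finset.range b, (k : ℝ) ^ 2 := by
    rw [Finset.sum_image (by intro _ _ _ _ h; simpa using h)]
    simp
  have h3 := Finset.sum_union_inter (s₁ := (Finset.range b).image (fun k : ℕ => (k : ℤ)))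
    (s₂ := (Finset.range b).image (fun k : ℕ => -(k : ℤ))) (f := fun τ : ℤ => (τ : ℝ) ^ 2)
  have h4 : 0 ≤ ∑ τ ∈ (Finset.range b).image (fun k : ℕ => (k : ℤ)) ∩
    (Finset.range b).image (fun k : ℕ => -(k : ℤ)), (τ : ℝ) ^ 2 :=
    Finset.sum_nonneg fun _ _ => sq_nonneg _
  have h5 := Finset.sum_le_sum_of_subset_of_nonneg hsub (f := fun τ : ℤ => (τ : ℝ) ^ 2)
    fun _ _ _ => sq_nonneg _
  have h6 := hcube b
  have hb' : (2 : ℝ) ≤ b := by exact_mod_cast hb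
  have h7 : 0 ≤ (b : ℝ) * (b - 1) * (b - 2) :=
    mul_nonneg (mul_nonneg (by linarith) (by linarith)) (by linarith)
  rw [h1, h2] at h3
  nlinarith

/-- The `ℓ₂`-norm of Walsh coefficients with nonzero digits at the positions `p i r`, `r < A i`,
is bounded in terms of the Vitali variation of order `A`. -/
theorem sum_sq_walshCoeff_le {ι : Type*} [Fintype ι] [DecidableEq ι] {b α : ℕ} (hb : 2 ≤ b)
    (hα : 1 ≤ α) {A : ι → ℕ} {p m : ι → Fin α → ℕ} (hM : ∀ i, IsMatching α (A i) (p i) (m i))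
    {g : (ι → ℝ) → ℝ} (hg : IntegrableOn g (unitCube ι)) (𝒦 : Finset (ι → ℕ))
    (h𝒦 : ∀ K ∈ 𝒦, ∀ i, ∀ r : Fin α, (r : ℕ) < A i → natDigit b (K i) (p i r) ≠ 0) :
    ENNReal.ofReal (∑ K ∈ 𝒦,
      ‖∫ x in unitCube ι, (g x : ℂ) * (starRingEnd ℂ) (prodWalsh b K x)‖ ^ 2) ≤
    ENNReal.ofReal (∏ i, ∏ r ∈ firstIdx α A i, (((b : ℝ) - 1) * digitUnit b (p i r)) ^ 2) *
      vitaliVariation b α A g ^ 2 := by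
  set j : StepIdx α A → ι := fun θ => θ.1.1
  set p' : StepIdx α A → ℕ := fun θ => p θ.1.1 θ.1.2 with hp'
  set S := ∑ K ∈ 𝒦, ‖∫ x in unitCube ι, (g x : ℂ) * (starRingEnd ℂ) (prodWalsh b K x)‖ ^ 2 with hS
  set V := vitaliVariation b α A g
  have hinj : ∀ θ θ', j θ = j θ' → p' θ = p' θ' → θ = θ' := by
    rintro ⟨⟨i, r⟩, h⟩ ⟨⟨i', r'⟩, h'⟩ (rfl : i = i') e
    have := (hM i).injOn h h' e
    simp_all
  -- The bound holds for each choice of target digits; the next step adds it over all $b^{|\theta|}$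
  -- choices, where $|\theta|$ is the number of steps.
  have h1 : ∀ c : StepIdx α A → Fin b, ENNReal.ofReal S ≤ ∫⁻ x in unitCube ι,
      ENNReal.ofReal (mixedDiff g x (digitSteps b j p' (digitDiff b j p' c x)) ^ 2) := by
    intro c
    have hi : IntegrableOn (fun x => mixedDiff g x (digitSteps b j p' (digitDiff b j p' c x)))
        (unitCube ι) :=
      integrable_finsetSum _ fun v _ =>
        (integrableOn_changed_point hb hinj hg c v).const_mul _
    refine le_trans (le_of_eq ?_) (bessel_prodWalsh hb hi 𝒦)
    congr 1
    refine Finset.sum_congr rfl fun K hK => ?_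
    rw [integral_mixedDiff_mul_prodWalsh hb hinj hg c fun θ => h𝒦 K hK θ.1.1 θ.1.2 θ.2]
  have h2 : ∑ _c : StepIdx α A → Fin b, ENNReal.ofReal S ≤
      ∑ τ ∈ Fintype.piFinset fun _ : StepIdx α A => (Finset.Icc (1 - (b : ℤ)) (b - 1)).erase 0,
        ENNReal.ofReal (∏ θ : StepIdx α A, ((τ θ : ℝ) * digitUnit b (p' θ)) ^ 2) * V ^ 2 := by
    refine (Finset.sum_le_sum fun c _ => h1 c).trans
      ((sum_lintegral_mixedDiff_le hb j p' g).trans (Finset.sum_le_sum fun τ hτ => ?_))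
    exact lintegral_mixedDiff_le hb hα hM (fun θ =>
      (Finset.mem_erase.1 (Fintype.mem_piFinset.1 hτ θ)).1) g
  rw [← Finset.sum_mul, ← ENNReal.ofReal_sum_of_nonneg fun τ _ =>
    Finset.prod_nonneg fun θ _ => sq_nonneg _, ← Finset.prod_univ_sum
      (fun _ : StepIdx α A => (Finset.Icc (1 - (b : ℤ)) (b - 1)).erase 0)
      (fun θ (τ : ℤ) => ((τ : ℝ) * digitUnit b (p' θ)) ^ 2), Finset.sum_const, nsmul_eq_mul] at h2
  have h3 : ∏ θ : StepIdx α A, ∑ τ ∈ (Finset.Icc (1 - (b : ℤ)) (b - 1)).erase 0,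
      ((τ : ℝ) * digitUnit b (p' θ)) ^ 2 ≤
      (b : ℝ) ^ Fintype.card (StepIdx α A) *
        ∏ i, ∏ r ∈ firstIdx α A i, (((b : ℝ) - 1) * digitUnit b (p i r)) ^ 2 := by
    rw [← prod_stepIdx A fun i r => (((b : ℝ) - 1) * digitUnit b (p i r)) ^ 2,
      ← Finset.card_univ, ← Finset.prod_const, ← Finset.prod_mul_distrib]
    refine Finset.prod_le_prod (fun θ _ => Finset.sum_nonneg fun _ _ => sq_nonneg _) fun θ _ => ?_
    simp only [mul_pow]
    rw [← Finset.sum_mul, ← mul_assoc]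
    exact mul_le_mul_of_nonneg_right (sum_sq_digit_changes_le hb) (sq_nonneg _)
  have h4 : ((Finset.univ : Finset (StepIdx α A → Fin b)).card : ENNReal) * ENNReal.ofReal S ≤
      ((Finset.univ : Finset (StepIdx α A → Fin b)).card : ENNReal) *
      (ENNReal.ofReal (∏ i, ∏ r ∈ firstIdx α A i, (((b : ℝ) - 1) * digitUnit b (p i r)) ^ 2) *
        V ^ 2) := by
    refine h2.trans ?_
    rw [← mul_assoc]
    refine mul_le_mul_left ?_ _
    refine (ENNReal.ofReal_le_ofReal h3).trans_eq ?_
    rw [ENNReal.ofReal_mul (by positivity), ← ENNReal.ofReal_natCast]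
    congr 2
    simp
  refine (ENNReal.mul_le_mul_iff_right ?_ (ENNReal.natCast_ne_top _)).1 h4
  rw [Finset.card_univ, Fintype.card_fun, Fintype.card_fin]
  exact_mod_cast pow_ne_zero _ (by omega)

/-! ### Interlaced indices -/

lemma natDigit_sum {b : ℕ} (hb : 2 ≤ b) (n : ℕ) : ∀ (N : ℕ) (D : ℕ → ℕ), (∀ q, D q < b) → n < N →
    natDigit b (∑ q ∈ Finset.range N, D q * b ^ q) n = D n := by
  have hfact : ∀ (N : ℕ) (D : ℕ → ℕ), ∑ q ∈ Finset.range (N + 1), D q * b ^ q =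
      b * (∑ q ∈ Finset.range N, D (q + 1) * b ^ q) + D 0 := fun N D => by
    rw [Finset.sum_range_succ', Finset.mul_sum]
    congr 1
    · exact Finset.sum_congr rfl fun q _ => by rw [pow_succ]; ring
    · simp
  induction n with
  | zero =>
    intro N D hD hN
    obtain ⟨N, rfl⟩ := Nat.exists_eq_add_of_le' hN
    rw [hfact, natDigit, pow_zero, Nat.div_one, Nat.mul_add_mod, Nat.mod_eq_of_lt (hD 0)]
  | succ n ih =>
    intro N D hD hN
    obtain ⟨N, rfl⟩ := Nat.exists_eq_add_of_le' (show 1 ≤ N by omega)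
    rw [hfact, natDigit, pow_succ', ← Nat.div_div_eq_div_mul, Nat.mul_add_div (by omega),
      Nat.div_eq_of_lt (hD 0), add_zero]
    exact ih N (fun q => D (q + 1)) (fun q => hD _) (by omega)

/-- The interlaced sum, reindexed by $q=r+ad$, is a base $b$ expansion with digits below $b$, so its
digits can be read off. -/
lemma natDigit_interlaceNat {b d : ℕ} (hb : 2 ≤ b) (k : Fin d → ℕ) (r : Fin d) (a : ℕ) :
    natDigit b (interlaceNat b d k) (r + a * d) = natDigit b (k r) a := by
  have hd : 0 < d := Fin.pos r
  set M := (∑ r, k r) + a + 1 with hM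
  have hk : ∀ r, k r ≤ M := fun r => by
    have := Finset.single_le_sum (f := k) (fun _ _ => Nat.zero_le _) (Finset.mem_univ r)
    omega
  set D : ℕ → ℕ := fun q => natDigit b (k ⟨q % d, Nat.mod_lt q hd⟩) (q / d) with hD
  have hDr : ∀ (r : Fin d) (a : ℕ), D (r + a * d) = natDigit b (k r) a := fun r a => by
    have h1 : ((r : ℕ) + a * d) % d = r := by
      rw [Nat.add_mul_mod_self_right, Nat.mod_eq_of_lt r.2]
    have h2 : ((r : ℕ) + a * d) / d = a := by
      rw [Nat.add_mul_div_right _ _ hd, Nat.div_eq_of_lt r.2, zero_add]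
    simp only [hD, h2]
    congr 2
    exact Fin.ext h1
  have key : interlaceNat b d k = ∑ q ∈ Finset.range (M * d), D q * b ^ q := by
    have h1 : interlaceNat b d k = ∑ r : Fin d, ∑ a ∈ Finset.range M,
        natDigit b (k r) a * b ^ ((r : ℕ) + a * d) := by
      refine Finset.sum_congr rfl fun r _ => ?_
      refine Finset.sum_subset (Finset.range_mono (hk r)) fun a _ ha => ?_
      rw [natDigit_eq_zero hb (by simpa using ha), zero_mul]
    rw [h1, ← Finset.sum_product']
    refine Finset.sum_bij' (fun x _ => (x.1 : ℕ) + x.2 * d)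
      (fun q _ => (⟨q % d, Nat.mod_lt q hd⟩, q / d)) ?_ ?_ ?_ ?_ ?_
    · rintro ⟨r, a⟩ h
      have ha : a < M := by simpa using h
      have h2 := r.2
      refine Finset.mem_range.2 ?_
      calc (r : ℕ) + a * d < d + a * d := by omega
        _ = (a + 1) * d := by ring
        _ ≤ M * d := Nat.mul_le_mul_right _ ha
    · intro q hq
      have := Finset.mem_range.1 hq
      simpa using Nat.div_lt_of_lt_mul (by rwa [mul_comm])
    · rintro ⟨r, a⟩ _
      refine Prod.ext (Fin.ext ?_) ?_
      · simp [Nat.add_mul_mod_self_right, Nat.mod_eq_of_lt r.2]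
      · simp [Nat.add_mul_div_right _ _ hd, Nat.div_eq_of_lt r.2]
    · intro q _
      exact Nat.mod_add_div' q d
    · rintro ⟨r, a⟩ _
      simp only [hDr]
  rw [key]
  refine (natDigit_sum hb _ _ D (fun q => natDigit_lt hb _ _) ?_).trans (hDr r a)
  have h2 := r.2
  calc (r : ℕ) + a * d < d + a * d := by omega
    _ = (a + 1) * d := by ring
    _ ≤ M * d := Nat.mul_le_mul_right _ (by omega)

lemma interlaceNat_injective {b d : ℕ} (hb : 2 ≤ b) : Function.Injective (interlaceNat b d) := by
  intro k k' h
  funext r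
  exact eq_of_natDigit_eq hb fun a => by
    rw [← natDigit_interlaceNat hb k r a, ← natDigit_interlaceNat hb k' r a, h]

/-- For $l\ge1$ the block condition is $b^{l-1}\le k<b^l$, so $k/b^{l-1}$ is the leading digit
itself. -/
lemma natDigit_lead_ne_zero {b k l : ℕ} (hb : 2 ≤ b) (hl : 0 < l)
    (hk : k ∈ Finset.Ico (b ^ l / b) (b ^ l)) : natDigit b k (l - 1) ≠ 0 := by
  obtain ⟨l, rfl⟩ := Nat.exists_eq_add_of_le' hl
  obtain ⟨h1, h2⟩ := Finset.mem_Ico.1 hk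
  rw [pow_succ, Nat.mul_div_cancel _ (by omega)] at h1
  have h3 : k / b ^ l < b := by
    rw [Nat.div_lt_iff_lt_mul (by positivity), ← pow_succ']
    exact h2
  rw [natDigit, Nat.add_sub_cancel, Nat.mod_eq_of_lt h3]
  exact (Nat.div_pos h1 (by positivity)).ne'

/-! ### Projections and Walsh coefficients -/

/-- Digits live on the half-open cube, Walsh coefficients and projections on the closed one; the
difference is a null set. -/
lemma restrict_unitCube {ι : Type*} [Fintype ι] :
    (volume : Measure (ι → ℝ)).restrict (unitCube ι) =
      volume.restrict (Set.Icc (0 : ι → ℝ) 1) :=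
  Measure.restrict_congr_set Measure.univ_pi_Ico_ae_eq_Icc

section Projection

variable {s : ℕ} (u : Finset (Fin s))

lemma piEquivPiSubtypeProd_symm_eq_combine (z : ({i // i ∈ u} → ℝ) × ({i // i ∉ u} → ℝ)) :
    (MeasurableEquiv.piEquivPiSubtypeProd (fun _ : Fin s => ℝ) (· ∈ u)).symm z =
      combine u z.1 z.2 := by
  funext i
  by_cases h : i ∈ u <;> simp [combine, h, MeasurableEquiv.piEquivPiSubtypeProd,
    Equiv.piEquivPiSubtypeProd]

lemma measurePreserving_combine :
    MeasurePreserving (fun z : ({i // i ∈ u} → ℝ) × ({i // i ∉ u} → ℝ) => combine u z.1 z.2) := by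
  have h := (volume_preserving_piEquivPiSubtypeProd (fun _ : Fin s => ℝ) (· ∈ u)).symm
  have e : ⇑(MeasurableEquiv.piEquivPiSubtypeProd (fun _ : Fin s => ℝ) (· ∈ u)).symm =
      fun z => combine u z.1 z.2 := funext (piEquivPiSubtypeProd_symm_eq_combine u)
  rw [e] at h
  convert h

lemma measurableEmbedding_combine :
    MeasurableEmbedding
      (fun z : ({i // i ∈ u} → ℝ) × ({i // i ∉ u} → ℝ) => combine u z.1 z.2) := by
  have e : ⇑(MeasurableEquiv.piEquivPiSubtypeProd (fun _ : Fin s => ℝ) (· ∈ u)).symm =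
      fun z => combine u z.1 z.2 := funext (piEquivPiSubtypeProd_symm_eq_combine u)
  rw [← e]
  exact MeasurableEquiv.measurableEmbedding _

lemma preimage_combine_Icc :
    (fun z : ({i // i ∈ u} → ℝ) × ({i // i ∉ u} → ℝ) => combine u z.1 z.2) ⁻¹'
      Set.Icc 0 1 = Set.Icc 0 1 ×ˢ Set.Icc 0 1 := by
  ext ⟨x, y⟩
  simp only [Set.mem_preimage, Set.mem_Icc, Pi.le_def, Set.mem_prod, Pi.zero_apply, Pi.one_apply]
  constructor
  · rintro ⟨h0, h1⟩
    refine ⟨⟨fun i => ?_, fun i => ?_⟩, fun i => ?_, fun i => ?_⟩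
    · simpa [combine, i.2] using h0 i
    · simpa [combine, i.2] using h1 i
    · simpa [combine, i.2] using h0 i
    · simpa [combine, i.2] using h1 i
  · rintro ⟨⟨h0, h1⟩, h2, h3⟩
    refine ⟨fun i => ?_, fun i => ?_⟩
    · by_cases h : i ∈ u
      · simpa [combine, h] using h0 ⟨i, h⟩
      · simpa [combine, h] using h2 ⟨i, h⟩
    · by_cases h : i ∈ u
      · simpa [combine, h] using h1 ⟨i, h⟩
      · simpa [combine, h] using h3 ⟨i, h⟩

lemma integrableOn_combine {E : Type*} [NormedAddCommGroup E] {f : (Fin s → ℝ) → E}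
    (hf : IntegrableOn f (Set.Icc 0 1)) :
    IntegrableOn (fun z : ({i // i ∈ u} → ℝ) × ({i // i ∉ u} → ℝ) => f (combine u z.1 z.2))
      (Set.Icc 0 1 ×ˢ Set.Icc 0 1) := by
  rw [← preimage_combine_Icc]
  exact ((measurePreserving_combine u).integrableOn_comp_preimage
    (measurableEmbedding_combine u)).2 hf

lemma integrableOn_projection {f : (Fin s → ℝ) → ℝ} (hf : IntegrableOn f (Set.Icc 0 1)) :
    IntegrableOn (projection u f) (unitCube {i // i ∈ u}) := by
  have h := integrableOn_combine u hf
  rw [IntegrableOn, Measure.volume_eq_prod, ← Measure.prod_restrict] at h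
  rw [IntegrableOn, restrict_unitCube]
  exact h.integral_prod_left

/-- Since $\mathrm{wal}_0=1$, coordinates with index $0$ can be integrated out by Fubini. -/
lemma walshCoeff_eq_projection {b : ℕ} (hb : 2 ≤ b) {f : (Fin s → ℝ) → ℝ}
    (hf : IntegrableOn f (Set.Icc 0 1)) {K : Fin s → ℕ} (hK : ∀ i ∉ u, K i = 0) :
    walshCoeff b f K = ∫ x in unitCube {i // i ∈ u},
      (projection u f x : ℂ) * (starRingEnd ℂ) (prodWalsh b (fun i : {i // i ∈ u} => K i) x) := by
  have hint : IntegrableOn (fun x => (f x : ℂ) * (starRingEnd ℂ) (prodWalsh b K x))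
      (Set.Icc 0 1) := by
    have h := hf
    rw [IntegrableOn, ← restrict_unitCube] at h
    have := integrableOn_mul_prodWalsh hb (g := fun x => (f x : ℂ)) h.ofReal K
    rwa [IntegrableOn, restrict_unitCube] at this
  have hprod : ∀ (x : {i // i ∈ u} → ℝ) (y : {i // i ∉ u} → ℝ),
      prodWalsh b K (combine u x y) = prodWalsh b (fun i : {i // i ∈ u} => K i) x := by
    intro x y
    rw [prodWalsh, ← Fintype.prod_subtype_mul_prod_subtype (· ∈ u)]
    have h1 : ∏ i : {i // i ∉ u}, walsh b (K i) (combine u x y i) = 1 :=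
      Finset.prod_eq_one fun i _ => by rw [hK i i.2]; simp [walsh]
    rw [h1, mul_one, prodWalsh]
    refine Finset.prod_congr (by ext; simp) fun i _ => ?_
    simp [combine, i.2]
  have h1 : walshCoeff b f K =
      ∫ z in (Set.Icc 0 1 ×ˢ Set.Icc 0 1 : Set (({i // i ∈ u} → ℝ) × ({i // i ∉ u} → ℝ))),
        (f (combine u z.1 z.2) : ℂ) * (starRingEnd ℂ) (prodWalsh b K (combine u z.1 z.2)) := by
    rw [← preimage_combine_Icc]
    exact ((measurePreserving_combine u).setIntegral_preimage_emb
      (measurableEmbedding_combine u)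
      (fun x => (f x : ℂ) * (starRingEnd ℂ) (prodWalsh b K x)) _).symm
  have h2 := integrableOn_combine u hint
  rw [Measure.volume_eq_prod] at h1 h2
  rw [h1, setIntegral_prod _ h2, restrict_unitCube]
  refine integral_congr_ae (Filter.Eventually.of_forall fun x => ?_)
  simp only [hprod]
  rw [integral_mul_const, integral_complex_ofReal]
  rfl

end Projection

/-! ### From the block of indices to a single Vitali variation. -/

section Main

variable {b α d s : ℕ}

/-- The interlaced indices of a block, restricted to the coordinates in `u`. -/
noncomputable def blockIndices (b d : ℕ) {s : ℕ} (l : Fin s → Fin d → ℕ) (u : Finset (Fin s)) :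
    Finset ({i // i ∈ u} → ℕ) :=
  (walshBlock b d l).image fun k i => interlaceNat b d (k i)

lemma eq_zero_of_mem_walshBlock {l : Fin s → Fin d → ℕ} {k : Fin s → Fin d → ℕ}
    (hk : k ∈ walshBlock b d l) {i : Fin s} (hi : ¬ (support (l i)).Nonempty) : k i = 0 := by
  funext r
  have hr : l i r = 0 := by
    by_contra h
    exact hi ⟨r, by simp [support]; omega⟩
  have := Fintype.mem_piFinset.1 (Fintype.mem_piFinset.1 hk i) r
  rw [hr] at this
  simpa using (Finset.mem_Ico.1 this).2

/-- Entries of the block outside $u$ are forced to be $0$ and interlacing is injective, so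
restricting indices to $u$ identifies no two of them. -/
lemma sum_sq_walshCoeff_eq (hb : 2 ≤ b) {f : (Fin s → ℝ) → ℝ} (hf : IntegrableOn f (Set.Icc 0 1))
    (l : Fin s → Fin d → ℕ) {u : Finset (Fin s)} (hu : ∀ i, i ∈ u ↔ (support (l i)).Nonempty) :
    ∑ k ∈ walshBlock b d l, ‖walshCoeff b f (fun i => interlaceNat b d (k i))‖ ^ 2 =
      ∑ K ∈ blockIndices b d l u, ‖∫ x in unitCube {i // i ∈ u},
        (projection u f x : ℂ) * (starRingEnd ℂ) (prodWalsh b K x)‖ ^ 2 := by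
  have h0 : ∀ k ∈ walshBlock b d l, ∀ i ∉ u, k i = 0 := fun k hk i hi =>
    eq_zero_of_mem_walshBlock hk fun h => hi ((hu i).2 h)
  rw [blockIndices, Finset.sum_image]
  · refine Finset.sum_congr rfl fun k hk => ?_
    rw [walshCoeff_eq_projection u hb hf]
    intro i hi
    simp [h0 k hk i hi, interlaceNat]
  · intro k hk k' hk' h
    funext i
    by_cases hi : i ∈ u
    · exact interlaceNat_injective hb (congrFun h ⟨i, hi⟩)
    · rw [h0 k hk i hi, h0 k' hk' i hi]

lemma gammaFactor_nonneg (hb : 2 ≤ b) (d r l : ℕ) : 0 ≤ gammaFactor b d r l := by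
  have : (2 : ℝ) ≤ b := by exact_mod_cast hb
  exact mul_nonneg (by linarith) (zpow_nonneg (by linarith) _)

lemma gamma_nonneg (hb : 2 ≤ b) (α : ℕ) (l : Fin s → Fin d → ℕ) : 0 ≤ gamma b d α l :=
  Finset.prod_nonneg fun _ _ => Finset.prod_nonneg fun _ _ => gammaFactor_nonneg hb _ _ _

lemma gamma_eq_prod_subtype (b α : ℕ) (l : Fin s → Fin d → ℕ) {u : Finset (Fin s)}
    (hu : ∀ i, i ∈ u ↔ (support (l i)).Nonempty) :
    gamma b d α l = ∏ i : {i // i ∈ u}, ∏ r ∈ smallest b d α (l i), gammaFactor b d r (l i r) := by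
  rw [gamma, ← Finset.prod_subset (Finset.subset_univ u), ← Finset.prod_coe_sort]
  intro i _ hi
  have h0 : support (l i) = ∅ := Finset.not_nonempty_iff_eq_empty.1 fun h => hi ((hu i).2 h)
  simp [smallest, h0]

/-- The bound for the Walsh coefficients of a block by a single Vitali variation. -/
lemma exists_vitaliVariation_bound (hb : 2 ≤ b) (hα : 1 ≤ α) {f : (Fin s → ℝ) → ℝ}
    (hf : IntegrableOn f (Set.Icc 0 1)) (l : Fin s → Fin d → ℕ) :
    ∃ (u : Finset (Fin s)) (A : {i // i ∈ u} → ℕ), (∀ i, A i ∈ Finset.Icc 1 α) ∧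
      ENNReal.ofReal (∑ k ∈ walshBlock b d l,
        ‖walshCoeff b f (fun i => interlaceNat b d (k i))‖ ^ 2) ≤
      ENNReal.ofReal (gamma b d α l ^ 2) * vitaliVariation b α A (projection u f) ^ 2 := by
  set u := Finset.univ.filter fun i => (support (l i)).Nonempty with hu'
  have hu : ∀ i, i ∈ u ↔ (support (l i)).Nonempty := fun i => by simp [hu']
  -- The order of the difference in coordinate $i$ is the number of selected factors, so one Vitali
  -- variation, of a single order $A$ and projection $f_u$, bounds the whole block.
  set T : {i // i ∈ u} → Finset ℕ := fun i => (smallest b d α (l i)).image (leadPos d (l i))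
    with hT
  have hTc : ∀ i, (T i).card = (smallest b d α (l i)).card := fun i =>
    Finset.card_image_of_injective _ (leadPos_injective d _)
  have hTα : ∀ i, (T i).card ≤ α := fun i => hTc i ▸ (card_smallest_le hb d α hα (l i)).1
  choose p m hM hp using fun i => exists_isMatching hα (T i) (hTα i)
  refine ⟨u, fun i => (T i).card, fun i => Finset.mem_Icc.2 ⟨?_, hTα i⟩, ?_⟩
  · change 1 ≤ (T i).card
    rw [hTc, Nat.one_le_iff_ne_zero, Finset.card_ne_zero]
    exact (card_smallest_le hb d α hα (l i)).2 ((hu i).1 i.2)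
  rw [sum_sq_walshCoeff_eq hb hf l hu]
  refine (sum_sq_walshCoeff_le hb hα hM (integrableOn_projection u hf) _ ?_).trans_eq ?_
  · intro K hK i r hr
    obtain ⟨k, hk, rfl⟩ := Finset.mem_image.1 hK
    obtain ⟨r', hr', e⟩ := Finset.mem_image.1 (Finset.mem_coe.1 ((hp i).mapsTo hr))
    have hl : 0 < l i r' := by
      simpa [support] using (Finset.mem_filter.1 hr').1
    rw [← e, leadPos, natDigit_interlaceNat hb]
    exact natDigit_lead_ne_zero hb hl (Fintype.mem_piFinset.1 (Fintype.mem_piFinset.1 hk i) r')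
  · congr 2
    rw [gamma_eq_prod_subtype b α l hu, ← Finset.prod_pow]
    refine Finset.prod_congr rfl fun i _ => ?_
    have hb' : Set.BijOn (p i) (firstIdx α (fun i => (T i).card) i) (T i) := by
      have e : ((firstIdx α (fun i => (T i).card) i : Finset (Fin α)) : Set (Fin α)) =
          {r : Fin α | (r : ℕ) < (T i).card} := by
        ext r
        simp [firstIdx]
      rw [e]
      exact hp i
    have himg : (firstIdx α (fun i => (T i).card) i).image (p i) = T i := by
      exact_mod_cast hb'.image_eq
    rw [← Finset.prod_image (f := fun n => (((b : ℝ) - 1) * digitUnit b n) ^ 2) hb'.injOn, himg,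
      Finset.prod_image fun _ _ _ _ h => leadPos_injective d _ h, ← Finset.prod_pow]
    refine Finset.prod_congr rfl fun r hr => ?_
    have hl : 0 < l i r := by
      simpa [support] using (Finset.mem_filter.1 hr).1
    rw [gammaFactor_eq b d (l i) r hl]

lemma vitaliVariation_sq_le (b α : ℕ) (f : (Fin s → ℝ) → ℝ) (u : Finset (Fin s))
    {A : {i // i ∈ u} → ℕ} (hA : ∀ i, A i ∈ Finset.Icc 1 α) :
    vitaliVariation b α A (projection u f) ^ 2 ≤ variation b α f ^ 2 := by
  have e : variation b α f ^ 2 = ∑ u : Finset (Fin s),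
      ∑ A ∈ Fintype.piFinset (fun _ : {i // i ∈ u} => Finset.Icc 1 α),
        vitaliVariation b α A (projection u f) ^ 2 := by
    rw [variation, ← ENNReal.rpow_natCast, ← ENNReal.rpow_mul]
    norm_num
  rw [e]
  refine le_trans ?_ (Finset.single_le_sum (fun _ _ => zero_le) (Finset.mem_univ u))
  exact Finset.single_le_sum
    (f := fun A : {i // i ∈ u} → ℕ => vitaliVariation b α A (projection u f) ^ 2)
    (fun _ _ => zero_le) (Fintype.mem_piFinset.2 hA)

lemma sigma_le_gamma_mul_variation (hb : 2 ≤ b) (hα : 1 ≤ α) {f : (Fin s → ℝ) → ℝ}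
    (hf : IntegrableOn f (Set.Icc 0 1)) (hV : variation b α f < ⊤) (l : Fin s → Fin d → ℕ) :
    sigma b d l f ≤ gamma b d α l * (variation b α f).toReal := by
  have h0 := mul_nonneg (gamma_nonneg hb α l) (ENNReal.toReal_nonneg (a := variation b α f))
  obtain ⟨u, A, hA, h⟩ := exists_vitaliVariation_bound hb hα hf l
  refine Real.sqrt_le_iff.2 ⟨h0, ?_⟩
  rw [← ENNReal.ofReal_le_ofReal_iff (sq_nonneg _), mul_pow, ENNReal.ofReal_mul (sq_nonneg _),
    ENNReal.ofReal_pow ENNReal.toReal_nonneg, ENNReal.ofReal_toReal hV.ne]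
  exact h.trans (mul_le_mul_right (vitaliVariation_sq_le b α f u hA) _)

end Main

end HigherOrderScrambling

theorem mainTheorem2 (b : ℕ) (hb : 2 ≤ b) (α d s : ℕ) (hα : 1 ≤ α) (hd : 1 ≤ d)
    (f : (Fin s → ℝ) → ℝ)
    (hf : MeasureTheory.IntegrableOn f (Set.Icc (0 : Fin s → ℝ) 1))
    (hV : HigherOrderScrambling.variation b α f < ⊤)
    (l : Fin s → Fin d → ℕ) :
    HigherOrderScrambling.sigma b d l f ≤
      2 ^ (s * max (d - α) 0) * HigherOrderScrambling.gamma b d α l *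
        (HigherOrderScrambling.variation b α f).toReal := by
  -- The bound holds with constant $1$, and the power of $2$ is at least $1$.
  refine (HigherOrderScrambling.sigma_le_gamma_mul_variation hb hα hf hV l).trans ?_
  rw [mul_assoc]
  exact le_mul_of_one_le_left
    (mul_nonneg (HigherOrderScrambling.gamma_nonneg hb α l) ENNReal.toReal_nonneg)
    (one_le_pow₀ one_le_two)
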